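/- Let $(M^3,\langle\cdot,\cdot\rangle)$ be a smooth three-dimensional Riemannian manifold, isometrically immersed into $\mathbb{R}^n$, $n\ge 4$, and let $\Sigma$ be a smooth surface, isometrically immersed in $M$, with a smooth unit normal field $N$ in $M$. Let $II(v,w)=\langle\overline\nabla_v W,N\rangle$ be its second fundamental form ($\overline\nabla$ being the Levi-Civita connection of $M$ and $W$ a tangent extension of $w$), $A$ its shape operator ($\langle Av,w\rangle=II(v,w)$), and assume that its mean curvature $\tfrac12\operatorname{tr}A$ is a constant $H$. Let $J$ be a complex structure on $\Sigma$ compatible with the metric, i.e. a smooth field of endomorphisms of $T\Sigma$ with $J^2=-\mathrm{Id}$ and $\langle JY,Z\rangle=-\langle Y,JZ\rangle$. Let $X$ be a harmonic vector field on $\Sigma$, i.e. a smooth tangent field with $\operatorname{div}X=0$ and $\langle\nabla_ZX,Y\rangle=\langle\nabla_YX,Z\rangle$ for all $Y,Z\in T\Sigma$, where $\nabla$ is the Levi-Civita connection of $\Sigma$. For a smooth function $f:\Sigma\to\mathbb{R}$ put $$Q(f,f)=f\,\Delta_\Sigma f+\bigl(\mathrm{Ric}_M(N,N)+\|A\|^2\bigr)f^2,$$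 where $\mathrm{Ric}_M$ is the (non-normalized) Ricci tensor. Let $E_1,\dots,E_n$ be the canonical basis of $\mathbb{R}^n$, regard tangent vectors of $\Sigma$ as vectors of $\mathbb{R}^n$ through the immersions $\Sigma\to M\to\mathbb{R}^n$, and let $u_i=\langle X,E_i\rangle$, $u_i^*=\langle JX,E_i\rangle$, $$Q(X,X)=\sum_{i=1}^nQ(u_i,u_i),\qquad Q(JX,JX)=\sum_{i=1}^nQ(u_i^*,u_i^*).$$ Then, at every point $p\in\Sigma$, for every orthonormal basis $e_1,e_2$ of $T_p\Sigma$ and every orthonormal basis $\overline N^4,\dots,\overline N^n$ of the normal space of $M$ in $\mathbb{R}^n$ at (the image of) $p$, $$Q(X,X)+Q(JX,JX)=(4H^2+6\,\mathrm{scal}_M)\|X\|^2-\sum_{\alpha=4}^n\sum_{i=1}^2\Bigl[\overline{II}^\alpha(e_i,X)^2+\overline{II}^\alpha(e_i,JX)^2\Bigr],$$ where $\mathrm{scal}_M$ is the normalized scalar curvature of $M$ (the mean of the three sectional curvatures of the coordinate planes of an orthonormal basis, i.e. $\tfrac16$ of the trace of $\mathrm{Ric}_M$) and $\overline{II}^\alpha(v,w)=\langle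 D_vW,\overline N^\alpha\rangle$ is the second fundamental form of $M$ in $\mathbb{R}^n$ in the direction $\overline N^\alpha$, $D$ being the flat connection of $\mathbb{R}^n$ and $W$ an extension of $w$ tangent to $M$. -/

import Mathlib

open scoped Manifold ContDiff Bundle

namespace RiemGeom

noncomputable section

/-- Euclidean space `ℝ^m`. -/
abbrev E (m : ℕ) : Type := EuclideanSpace ℝ (Fin m)

/-- A smooth (`C^∞`) Riemannian metric on an `m`-dimensional smooth manifold `M` without boundary. -/
abbrev RMetric (m : ℕ) (M : Type*) [TopologicalSpace M] [ChartedSpace (E m) M]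
    [IsManifold (𝓡 m) ∞ M] : Type _ :=
  Bundle.ContMDiffRiemannianMetric (𝓡 m) ∞ (E m) (fun x : M => TangentSpace (𝓡 m) x)

/-- The `i`-th standard basis vector of `ℝ^m`. -/
def stdVec {m : ℕ} (i : Fin m) : E m := EuclideanSpace.single i (1 : ℝ)

/-- The partial derivative `∂f/∂y_i` of a function on `ℝ^m`. -/
def pd {m : ℕ} (i : Fin m) (f : E m → ℝ) (y : E m) : ℝ := fderiv ℝ f y (stdVec i)

section Intrinsic

variable {m : ℕ} {M : Type*} [TopologicalSpace M] [ChartedSpace (E m) M]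

/-- The image of the point `p` in its own chart. -/
def base (p : M) : E m := extChartAt (𝓡 m) p p

/-- The components, in the chart at `p`, of a tangent vector `v` at the point `q`. -/
def toChart (p q : M) (v : TangentSpace (𝓡 m) q) : E m :=
  mfderiv (𝓡 m) 𝓘(ℝ, E m) (extChartAt (𝓡 m) p) q v

/-- The tangent vector, at the point with coordinates `y` in the chart at `p`, whose components
in that chart are `a`. -/
def fromChart (p : M) (y a : E m) : TangentSpace (𝓡 m) ((extChartAt (𝓡 m) p).symm y) :=
  mfderiv 𝓘(ℝ, E m) (𝓡 m) (extChartAt (𝓡 m) p).symm y a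

/-- The components of the vector field `X` in the chart at `p`, as functions of the coordinates. -/
def chartField (p : M) (X : (q : M) → TangentSpace (𝓡 m) q) (y : E m) : E m :=
  toChart p ((extChartAt (𝓡 m) p).symm y) (X ((extChartAt (𝓡 m) p).symm y))

variable [IsManifold (𝓡 m) ∞ M]

/-- The metric `g` read in the chart at `p`, on vectors given by their components. -/
def chartInner (g : RMetric m M) (p : M) (y a b : E m) : ℝ :=
  g.inner ((extChartAt (𝓡 m) p).symm y) (fromChart p y a) (fromChart p y b)

/-- The matrix `(g_ij)` of the metric in the chart at `p`, as a function of the coordinates. -/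
def gram (g : RMetric m M) (p : M) (y : E m) : Matrix (Fin m) (Fin m) ℝ :=
  Matrix.of fun i j => chartInner g p y (stdVec i) (stdVec j)

/-- The Christoffel symbols of the Levi-Civita connection in the chart at `p`:
`Γ^k_ij = ½ ∑_l g^{kl} (∂_i g_jl + ∂_j g_il - ∂_l g_ij)`. -/
def christoffel (g : RMetric m M) (p : M) (k i j : Fin m) (y : E m) : ℝ :=
  (1 / 2 : ℝ) * ∑ l, (gram g p y)⁻¹ k l *
    (pd i (fun z => gram g p z j l) y + pd j (fun z => gram g p z i l) y
      - pd l (fun z => gram g p z i j) y)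

/-- The vector with components `∑_ij Γ^k_ij a_i b_j`. -/
def christoffelVec (g : RMetric m M) (p : M) (y a b : E m) : E m :=
  ∑ k, (∑ i, ∑ j, christoffel g p k i j y * a i * b j) • stdVec k

/-- The components `R^l_{kij}` of the curvature tensor in the chart at `p`, where
`R(∂_i, ∂_j) ∂_k = ∇_i ∇_j ∂_k - ∇_j ∇_i ∂_k = ∑_l R^l_{kij} ∂_l`. -/
def riemann (g : RMetric m M) (p : M) (l k i j : Fin m) (y : E m) : ℝ :=
  pd i (christoffel g p l j k) y - pd j (christoffel g p l i k) y
    + ∑ s, (christoffel g p l i s y * christoffel g p s j k y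
      - christoffel g p l j s y * christoffel g p s i k y)

/-- The components `Ric_jk = ∑_i R^i_{kij}` of the Ricci tensor (the trace of
`U ↦ R(U, ∂_j) ∂_k`) in the chart at `p`. -/
def ricciCoord (g : RMetric m M) (p : M) (j k : Fin m) (y : E m) : ℝ :=
  ∑ i, riemann g p i k i j y

/-- The Ricci curvature `Ric(v, w)` (not normalized), for tangent vectors `v`, `w` at `p`. -/
def ricci (g : RMetric m M) (p : M) (v w : TangentSpace (𝓡 m) p) : ℝ :=
  ∑ j, ∑ k, ricciCoord g p j k (base p) * toChart p p v j * toChart p p w k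

/-- The normalized scalar curvature at `p`: the trace of the Ricci tensor divided by `m (m - 1)`,
i.e. the mean of the sectional curvatures of the coordinate planes of an orthonormal basis. -/
def normScal (g : RMetric m M) (p : M) : ℝ :=
  (∑ j, ∑ k, (gram g p (base p))⁻¹ j k * ricciCoord g p j k (base p)) / ((m : ℝ) * ((m : ℝ) - 1))

/-- The Laplace-Beltrami operator
`Δu = ∑_ij g^{ij} (∂_i ∂_j u - ∑_k Γ^k_ij ∂_k u)`, at the point `p`. -/
def laplacian (g : RMetric m M) (u : M → ℝ) (p : M) : ℝ :=
  ∑ i, ∑ j, (gram g p (base p))⁻¹ i j *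
    (pd i (pd j (u ∘ (extChartAt (𝓡 m) p).symm)) (base p)
      - ∑ k, christoffel g p k i j (base p) * pd k (u ∘ (extChartAt (𝓡 m) p).symm) (base p))

/-- `⟨∇_v X, w⟩` at the point `p`, where `∇` is the Levi-Civita connection; in the chart,
`(∇_v X)^k = v(X^k) + ∑_ij Γ^k_ij v^i X^j`. -/
def innerCovDeriv (g : RMetric m M) (X : (q : M) → TangentSpace (𝓡 m) q) (p : M)
    (v w : TangentSpace (𝓡 m) p) : ℝ :=
  chartInner g p (base p)
    (fderiv ℝ (chartField p X) (base p) (toChart p p v)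
      + christoffelVec g p (base p) (toChart p p v) (chartField p X (base p)))
    (toChart p p w)

/-- The vectors `e_1, …, e_m` form an orthonormal basis of the tangent space at `p`. -/
def IsOrthonormalAt (g : RMetric m M) (p : M) (e : Fin m → TangentSpace (𝓡 m) p) : Prop :=
  ∀ i j, g.inner p (e i) (e j) = if i = j then 1 else 0

/-- A smooth vector field `X` is harmonic if its dual `1`-form is closed
(`⟨∇_Z X, Y⟩ = ⟨∇_Y X, Z⟩`) and co-closed (`div X = 0`). -/
structure IsHarmonicField (g : RMetric m M) (X : (q : M) → TangentSpace (𝓡 m) q) : Prop where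
  smooth : ContMDiff (𝓡 m) (𝓡 m).tangent ∞ (fun q => (⟨q, X q⟩ : TangentBundle (𝓡 m) M))
  closed : ∀ (q : M) (Y Z : TangentSpace (𝓡 m) q),
    innerCovDeriv g X q Z Y = innerCovDeriv g X q Y Z
  coclosed : ∀ (q : M) (e : Fin m → TangentSpace (𝓡 m) q), IsOrthonormalAt g q e →
    ∑ i, innerCovDeriv g X q (e i) (e i) = 0

/-- `J` is a smooth field of endomorphisms of the tangent spaces with `J² = -Id` and
`⟨JY, Z⟩ = -⟨Y, JZ⟩`: a complex structure compatible with the metric. -/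
structure IsComplexStructure (g : RMetric m M)
    (J : (q : M) → TangentSpace (𝓡 m) q →L[ℝ] TangentSpace (𝓡 m) q) : Prop where
  smooth : ContMDiff (𝓡 m) ((𝓡 m).prod 𝓘(ℝ, E m →L[ℝ] E m)) ∞
    (fun q => Bundle.TotalSpace.mk' (E m →L[ℝ] E m)
      (E := fun q : M => TangentSpace (𝓡 m) q →L[ℝ] TangentSpace (𝓡 m) q) q (J q))
  sq : ∀ (q : M) (Y : TangentSpace (𝓡 m) q), J q (J q Y) = -Y
  skew : ∀ (q : M) (Y Z : TangentSpace (𝓡 m) q), g.inner q (J q Y) Z = -g.inner q Y (J q Z)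

/-- `φ : M → ℝ^n` is a smooth isometric immersion (injectivity of the differential follows from
the preservation of the metric). -/
structure IsIsometricImmersionEuclidean {n : ℕ} (g : RMetric m M) (φ : M → E n) : Prop where
  smooth : ContMDiff (𝓡 m) 𝓘(ℝ, E n) ∞ φ
  isometric : ∀ (q : M) (v w : TangentSpace (𝓡 m) q),
    inner ℝ (mvfderiv (𝓡 m) φ q v) (mvfderiv (𝓡 m) φ q w) = g.inner q v w

/-- The vectors `ν_a` form an orthonormal basis of the normal space of the immersion
`φ : M^m → ℝ^n` at `q` (their number being the codimension). -/
structure IsNormalBasisAt {n : ℕ} (φ : M → E n) (q : M) (ν : Fin (n - m) → E n) : Prop where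
  orthonormal : Orthonormal ℝ ν
  normal : ∀ (a : Fin (n - m)) (v : TangentSpace (𝓡 m) q), inner ℝ (mvfderiv (𝓡 m) φ q v) (ν a) = 0

/-- The second fundamental form `⟨D_v W, ν⟩` at `q` of the immersion `φ : M → ℝ^n` in the direction
of the normal vector `ν`. Here `W` extends `w` with constant components in the chart at `q`; its
image in `ℝ^n` is the derivative of `φ` (read in the chart) in the direction `w`. -/
def euclideanSFF {n : ℕ} (φ : M → E n) (ν : E n) (q : M) (v w : TangentSpace (𝓡 m) q) : ℝ :=
  inner ℝ
    (fderiv ℝ (fun z => fderiv ℝ (φ ∘ (extChartAt (𝓡 m) q).symm) z (toChart q q w)) (base q)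
      (toChart q q v)) ν

end Intrinsic

section Hypersurface

variable {m k : ℕ} {S M : Type*} [TopologicalSpace S] [ChartedSpace (E m) S]
  [TopologicalSpace M] [ChartedSpace (E k) M]

/-- The map `ψ : S → M` read in the charts at `p` and `ψ p`. -/
def chartMap (ψ : S → M) (p : S) (y : E m) : E k :=
  extChartAt (𝓡 k) (ψ p) (ψ ((extChartAt (𝓡 m) p).symm y))

variable [IsManifold (𝓡 m) ∞ S] [IsManifold (𝓡 k) ∞ M]

/-- `ψ : S → M` is a smooth isometric immersion: `gS` is the metric induced by `gM`. -/
structure IsIsometricImmersion (gS : RMetric m S) (gM : RMetric k M) (ψ : S → M) : Prop where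
  smooth : ContMDiff (𝓡 m) (𝓡 k) ∞ ψ
  isometric : ∀ (q : S) (v w : TangentSpace (𝓡 m) q),
    gM.inner (ψ q) (mfderiv (𝓡 m) (𝓡 k) ψ q v) (mfderiv (𝓡 m) (𝓡 k) ψ q w) = gS.inner q v w

/-- `N` is a smooth unit normal vector field along `ψ : S → M`. -/
structure IsUnitNormal (gM : RMetric k M) (ψ : S → M)
    (N : (q : S) → TangentSpace (𝓡 k) (ψ q)) : Prop where
  smooth : ContMDiff (𝓡 m) (𝓡 k).tangent ∞ (fun q => (⟨ψ q, N q⟩ : TangentBundle (𝓡 k) M))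
  unit : ∀ q : S, gM.inner (ψ q) (N q) (N q) = 1
  normal : ∀ (q : S) (v : TangentSpace (𝓡 m) q),
    gM.inner (ψ q) (mfderiv (𝓡 m) (𝓡 k) ψ q v) (N q) = 0

/-- The matrix at `p` of the second fundamental form `II(v, w) = ⟨∇'_v W, N⟩` in the chart at `p`,
where `∇'` is the Levi-Civita connection of `M`:
`II_ij = ⟨∂_i ∂_j ψ + Γ(∂_i ψ, ∂_j ψ), N⟩`. -/
def sffMatrix (gM : RMetric k M) (ψ : S → M) (N : (q : S) → TangentSpace (𝓡 k) (ψ q)) (p : S) :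
    Matrix (Fin m) (Fin m) ℝ :=
  Matrix.of fun i j => chartInner gM (ψ p) (base (m := k) (ψ p))
    (fderiv ℝ (fun z => fderiv ℝ (chartMap (m := m) (k := k) ψ p) z (stdVec j)) (base (m := m) p) (stdVec i)
      + christoffelVec gM (ψ p) (base (m := k) (ψ p))
        (fderiv ℝ (chartMap (m := m) (k := k) ψ p) (base (m := m) p) (stdVec i))
        (fderiv ℝ (chartMap (m := m) (k := k) ψ p) (base (m := m) p) (stdVec j)))
    (toChart (ψ p) (ψ p) (N p))

/-- The matrix of the shape operator `A` (`⟨A v, w⟩ = II(v, w)`) in the chart at `p`: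
`A^i_j = ∑_l g^{il} II_lj`. -/
def shapeMatrix (gS : RMetric m S) (gM : RMetric k M) (ψ : S → M)
    (N : (q : S) → TangentSpace (𝓡 k) (ψ q)) (p : S) : Matrix (Fin m) (Fin m) ℝ :=
  (gram gS p (base p))⁻¹ * sffMatrix gM ψ N p

/-- The (normalized) mean curvature `H = (tr A) / m`. -/
def meanCurvature (gS : RMetric m S) (gM : RMetric k M) (ψ : S → M)
    (N : (q : S) → TangentSpace (𝓡 k) (ψ q)) (p : S) : ℝ :=
  (shapeMatrix gS gM ψ N p).trace / (m : ℝ)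

/-- The squared norm `‖A‖² = tr (A²)` of the (self-adjoint) shape operator. -/
def shapeNormSq (gS : RMetric m S) (gM : RMetric k M) (ψ : S → M)
    (N : (q : S) → TangentSpace (𝓡 k) (ψ q)) (p : S) : ℝ :=
  (shapeMatrix gS gM ψ N p * shapeMatrix gS gM ψ N p).trace

/-- The integrand of the Jacobi operator, `Q(f, f) = f Δ_S f + (Ric_M(N, N) + ‖A‖²) f²`. -/
def jacobiQ (gS : RMetric m S) (gM : RMetric k M) (ψ : S → M)
    (N : (q : S) → TangentSpace (𝓡 k) (ψ q)) (f : S → ℝ) (p : S) : ℝ :=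
  f p * laplacian gS f p + (ricci gM (ψ p) (N p) (N p) + shapeNormSq gS gM ψ N p) * f p ^ 2

/-- The function `⟨X, E_i⟩` on `S`: the `i`-th coordinate in `ℝ^n` of the vector field `X`
tangent to `S`, for the immersions `S → M → ℝ^n`. -/
def coordFun {n : ℕ} (ψ : S → M) (φ : M → E n) (X : (q : S) → TangentSpace (𝓡 m) q) (i : Fin n)
    (q : S) : ℝ :=
  (mvfderiv (𝓡 k) φ (ψ q) (mfderiv (𝓡 m) (𝓡 k) ψ q (X q))) i

/-- `Q(X, X) = ∑_i Q(⟨X, E_i⟩, ⟨X, E_i⟩)`, for a vector field `X` tangent to `S`. -/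
def jacobiQField {n : ℕ} (gS : RMetric m S) (gM : RMetric k M) (ψ : S → M) (φ : M → E n)
    (N : (q : S) → TangentSpace (𝓡 k) (ψ q)) (X : (q : S) → TangentSpace (𝓡 m) q) (p : S) : ℝ :=
  ∑ i, jacobiQ gS gM ψ N (coordFun (m := m) (k := k) ψ φ X i) p

end Hypersurface

end

end RiemGeom

/-!
The idea is to compute everything in `ℝⁿ`. Let `F = φ ∘ ψ` be the immersion of the surface, read in
the chart at `p`, let `e₁, e₂` be orthonormal at `p`, let `B` be the second fundamental form of the
surface in `ℝⁿ`, and let `V = DF(X)` be the field `X` as an `ℝⁿ`-valued function. Summing over the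
coordinates, `Q(X, X) = ⟨V, ΔV⟩ + (Ric(N, N) + ‖A‖²) |X|²` (`jacobiQField_eq`).

The covariant derivative of `X` is the tangential part of the derivative of `V`, so that `X` is
harmonic when the form `⟨D_a V, DF b⟩` is symmetric and trace-free (`IsCoordHarmonic`), at `p` and at
all nearby points (`eventually_isCoordHarmonic`). Differentiating these two equations at `p` gives
Bochner's formula `⟨V, ΔV⟩ = K |X|² - ∑ |B(e_i, X)|²` with `K = ⟨B₁₁, B₂₂⟩ - |B₁₂|²` (`bochner`).
The complex structure is parallel (`inner_fderiv_complex`), hence `J X` is harmonic as well and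
the formula applies to it too.

Let `h_ij` be the components of the second fundamental form of the surface in `M`. Then
`B = B_M + h N`, where `B_M` is the second fundamental form of `M` in `ℝⁿ`. As `X` and `J X` are
orthogonal and of equal length, adding the two formulas gives `|X|²` times
`2 K + 2 Ric(N, N) + ‖A‖²`, minus the sum of the `|B_M(e_i, X)|² + |B_M(e_i, J X)|²`. By the Gauss
equation (`gauss`, `ricci_eq`, `normScal_eq`) `K = K_M + det h` with `K_M` the sectional curvature of
`M` on the tangent plane, and `2 K_M + 2 Ric(N, N) = 6 scal_M` (`sum_gaussForm_three`), while
`2 det h + ‖A‖² = (tr h)² = 4 H²`. Finally `|B_M(v, w)|²` is the sum of the squares of its components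
along the normal basis (`sum_sq_inner_normal`).
-/

namespace RiemGeom

open Filter Topology

/-! ### Second derivatives -/

section Calculus

variable {m k : ℕ} {W : Type*} [NormedAddCommGroup W] [NormedSpace ℝ W]

/-- The second derivative `D²F(a, b)` of `F` at `y`; the direction `a` is differentiated last. -/
noncomputable def D2 (F : E m → W) (y a b : E m) : W := fderiv ℝ (fderiv ℝ F) y a b

lemma D2_add_left (F : E m → W) (y a a' b : E m) :
    D2 F y (a + a') b = D2 F y a b + D2 F y a' b := by simp [D2]

lemma D2_smul_left (F : E m → W) (y a b : E m) (r : ℝ) :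
    D2 F y (r • a) b = r • D2 F y a b := by simp [D2]

lemma D2_add_right (F : E m → W) (y a b b' : E m) :
    D2 F y a (b + b') = D2 F y a b + D2 F y a b' := by simp [D2]

lemma D2_smul_right (F : E m → W) (y a b : E m) (r : ℝ) :
    D2 F y a (r • b) = r • D2 F y a b := by simp [D2]

lemma D2_sum_left {ι : Type*} (s : Finset ι) (F : E m → W) (y b : E m) (f : ι → E m) :
    D2 F y (∑ i ∈ s, f i) b = ∑ i ∈ s, D2 F y (f i) b := by
  simp [D2, map_sum]

lemma D2_sum_right {ι : Type*} (s : Finset ι) (F : E m → W) (y a : E m) (f : ι → E m) :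
    D2 F y a (∑ i ∈ s, f i) = ∑ i ∈ s, D2 F y a (f i) := by
  simp [D2, map_sum]

lemma contDiffAt_fderiv {F : E m → W} {y : E m} (hF : ContDiffAt ℝ ∞ F y) :
    ContDiffAt ℝ ∞ (fderiv ℝ F) y :=
  hF.fderiv_right (m := ∞) (by simp)

lemma contDiffAt_fderiv_apply {F : E m → W} {x : E m → E m} {y : E m} (hF : ContDiffAt ℝ ∞ F y)
    (hx : ContDiffAt ℝ ∞ x y) : ContDiffAt ℝ ∞ (fun z => fderiv ℝ F z (x z)) y :=
  (contDiffAt_fderiv hF).clm_apply hx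

lemma fderiv_fderiv_apply {F : E m → W} {y : E m} (hF : ContDiffAt ℝ ∞ F y) (a b : E m) :
    fderiv ℝ (fun z => fderiv ℝ F z b) y a = D2 F y a b := by
  rw [fderiv_clm_apply ((contDiffAt_fderiv hF).differentiableAt (by simp))
    (differentiableAt_const b)]
  simp [D2]

lemma fderiv_fderiv_field {F : E m → W} {x : E m → E m} {y : E m} (hF : ContDiffAt ℝ ∞ F y)
    (hx : ContDiffAt ℝ ∞ x y) (a : E m) :
    fderiv ℝ (fun z => fderiv ℝ F z (x z)) y a = D2 F y a (x y) + fderiv ℝ F y (fderiv ℝ x y a) := by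
  rw [fderiv_clm_apply ((contDiffAt_fderiv hF).differentiableAt (by simp))
    (hx.differentiableAt (by simp))]
  simp [D2, add_comm]

lemma D2_comm {F : E m → W} {y : E m} (hF : ContDiffAt ℝ ∞ F y) (a b : E m) :
    D2 F y a b = D2 F y b a :=
  (hF.isSymmSndFDerivAt (by
    rw [minSmoothness_of_isRCLikeNormedField]
    exact WithTop.coe_le_coe.2 (le_top : (2 : ℕ∞) ≤ ⊤))).eq a b

/-- The chain rule for second derivatives. -/
lemma D2_comp {G : E k → W} {c : E m → E k} {y : E m}
    (hG : ∀ᶠ z in 𝓝 (c y), ContDiffAt ℝ ∞ G z) (hc : ∀ᶠ z in 𝓝 y, ContDiffAt ℝ ∞ c z) (a b : E m) :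
    D2 (G ∘ c) y a b
      = D2 G (c y) (fderiv ℝ c y a) (fderiv ℝ c y b) + fderiv ℝ G (c y) (D2 c y a b) := by
  have hcy := hc.self_of_nhds
  have hGy := hG.self_of_nhds
  have hcd : DifferentiableAt ℝ c y := hcy.differentiableAt (by simp)
  have key : fderiv ℝ (G ∘ c) =ᶠ[𝓝 y] fun z => (fderiv ℝ G (c z)).comp (fderiv ℝ c z) := by
    filter_upwards [hcd.continuousAt.eventually hG, hc] with z hz1 hz2
    exact fderiv_comp z (hz1.differentiableAt (by simp)) (hz2.differentiableAt (by simp))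
  have h1 : HasFDerivAt (fun z => fderiv ℝ G (c z))
      ((fderiv ℝ (fderiv ℝ G) (c y)).comp (fderiv ℝ c y)) y :=
    HasFDerivAt.comp (g := fderiv ℝ G) y
      ((contDiffAt_fderiv hGy).differentiableAt (by simp)).hasFDerivAt hcd.hasFDerivAt
  have h2 : HasFDerivAt (fderiv ℝ c) (fderiv ℝ (fderiv ℝ c) y) y :=
    ((contDiffAt_fderiv hcy).differentiableAt (by simp)).hasFDerivAt
  unfold D2
  rw [key.fderiv_eq, (h1.clm_comp h2).fderiv]
  simp [add_comm]

end Calculus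

/-! ### Orthonormal frames and normal components -/

section NormalPart

variable {m n : ℕ}

/-- The component of `v` orthogonal to the vectors `u a`, which are meant to be orthonormal. -/
noncomputable def normalPart {ι : Type*} [Fintype ι] (u : ι → E n) (v : E n) : E n :=
  v - ∑ a, (inner ℝ v (u a) : ℝ) • u a

lemma inner_normalPart {ι : Type*} [Fintype ι] {u : ι → E n} (hu : Orthonormal ℝ u) (v : E n)
    (a : ι) : inner ℝ (normalPart u v) (u a) = (0 : ℝ) := by
  classical
  rw [normalPart, inner_sub_left, sum_inner]
  simp [inner_smul_left, orthonormal_iff_ite.1 hu]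

lemma normalPart_add {ι : Type*} [Fintype ι] (u : ι → E n) (v w : E n) :
    normalPart u (v + w) = normalPart u v + normalPart u w := by
  simp only [normalPart, inner_add_left, add_smul, Finset.sum_add_distrib]
  abel

lemma normalPart_smul {ι : Type*} [Fintype ι] (u : ι → E n) (r : ℝ) (v : E n) :
    normalPart u (r • v) = r • normalPart u v := by
  simp only [normalPart, inner_smul_left, mul_smul, conj_trivial, smul_sub, Finset.smul_sum]

lemma eq_add_normalPart_two (u : Fin 2 → E n) (v : E n) :
    v = (inner ℝ v (u 0) : ℝ) • u 0 + (inner ℝ v (u 1) : ℝ) • u 1 + normalPart u v := by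
  simp [normalPart, Fin.sum_univ_two]

lemma orthonormal_of_frame {L : E m →L[ℝ] E n} {f : Fin m → E m}
    (hf : ∀ a b, inner ℝ (L (f a)) (L (f b)) = if a = b then (1 : ℝ) else 0) :
    Orthonormal ℝ (fun a => L (f a)) := by
  rw [orthonormal_iff_ite]; exact hf

lemma exists_coords {L : E m →L[ℝ] E n} {f : Fin m → E m}
    (hf : ∀ a b, inner ℝ (L (f a)) (L (f b)) = if a = b then (1 : ℝ) else 0) (v : E m) :
    ∃ c : Fin m → ℝ, v = ∑ a, c a • f a := by
  have hli : LinearIndependent ℝ f :=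
    LinearIndependent.of_comp L.toLinearMap (orthonormal_of_frame hf).linearIndependent
  let b := basisOfLinearIndependentOfCardEqFinrank' f hli (by simp)
  refine ⟨fun a => b.repr v a, ?_⟩
  have := b.sum_repr v
  simpa [b] using this.symm

lemma normalPart_map {L : E m →L[ℝ] E n} {f : Fin m → E m}
    (hf : ∀ a b, inner ℝ (L (f a)) (L (f b)) = if a = b then (1 : ℝ) else 0) (v : E m) :
    normalPart (fun a => L (f a)) (L v) = 0 := by
  obtain ⟨c, hc⟩ := exists_coords hf v
  rw [hc, normalPart, sub_eq_zero]
  simp only [map_sum, map_smul, sum_inner, inner_smul_left, hf]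
  simp

lemma inner_normalPart_map {L : E m →L[ℝ] E n} {f : Fin m → E m}
    (hf : ∀ a b, inner ℝ (L (f a)) (L (f b)) = if a = b then (1 : ℝ) else 0) (w : E n) (v : E m) :
    inner ℝ (normalPart (fun a => L (f a)) w) (L v) = (0 : ℝ) := by
  obtain ⟨c, hc⟩ := exists_coords hf v
  rw [hc]
  simp only [map_sum, map_smul, inner_sum, inner_smul_right]
  exact Finset.sum_eq_zero fun a _ => by
    rw [inner_normalPart (orthonormal_of_frame hf) w a, mul_zero]

/-- A vector whose tangential part is `L v` differs from `L v` by its normal part. With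
`v = Γ(a, b)` this turns Christoffel symbols into second fundamental forms. -/
lemma normalPart_eq_of_inner_eq {L : E m →L[ℝ] E n} {f : Fin m → E m}
    (hf : ∀ a b, inner ℝ (L (f a)) (L (f b)) = if a = b then (1 : ℝ) else 0) {w : E n} {v : E m}
    (hv : ∀ b, (inner ℝ (L v) (L b) : ℝ) = inner ℝ w (L b)) :
    w - L v = normalPart (fun a => L (f a)) w := by
  have h1 : normalPart (fun a => L (f a)) (w - L v) = w - L v := by
    simp [normalPart, inner_sub_left, hv]
  rw [← h1, sub_eq_add_neg, ← map_neg, normalPart_add, normalPart_map hf, add_zero]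

lemma exists_coords_of_orthonormal (L : E 2 →L[ℝ] E n) (e : Fin 2 → E 2)
    (he : ∀ i j, inner ℝ (L (e i)) (L (e j)) = if i = j then (1 : ℝ) else 0) (v : E 2) :
    ∃ α β : ℝ, v = α • e 0 + β • e 1 := by
  obtain ⟨c, hc⟩ := exists_coords he v
  exact ⟨c 0, c 1, by rw [hc, Fin.sum_univ_two]⟩

end NormalPart

/-! ### Bochner's formula for harmonic fields on an immersed surface -/

section Bochner

variable {m n : ℕ}

/-- Derivative of `⟨P, DF b⟩`. -/
lemma fderiv_inner_fderiv {F : E m → E n} {P : E m → E n} {y : E m} (hF : ContDiffAt ℝ ∞ F y)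
    (hP : DifferentiableAt ℝ P y) (a b : E m) :
    fderiv ℝ (fun z => inner ℝ (P z) (fderiv ℝ F z b)) y a
      = inner ℝ (fderiv ℝ P y a) (fderiv ℝ F y b) + inner ℝ (P y) (D2 F y a b) := by
  rw [fderiv_inner_apply ℝ hP ((contDiffAt_fderiv_apply hF contDiffAt_const).differentiableAt
    (by simp)), fderiv_fderiv_apply hF]
  ring

lemma differentiableAt_inner_fderiv {F : E m → E n} {P : E m → E n} {y : E m}
    (hF : ContDiffAt ℝ ∞ F y) (hP : DifferentiableAt ℝ P y) (b : E m) :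
    DifferentiableAt ℝ (fun z => inner ℝ (P z) (fderiv ℝ F z b)) y :=
  hP.inner ℝ ((contDiffAt_fderiv_apply hF contDiffAt_const).differentiableAt (by simp))

/-- The algebra behind `bochner`, at one point and in an orthonormal frame. Here `F1, F2` are the
frame, `F_ab` the second derivatives of the immersion with normal parts `B_ab` and tangential
coefficients `b_abc`, and `V_a`, `V_ab` the derivatives of the field `V = α F1 + β F2`; `hc1`, `hc2`
are the derivatives of `⟨V_1, F_2⟩ = ⟨V_2, F_1⟩` and `hd1`, `hd2` those of the vanishing of the
divergence. They eliminate all second derivatives of `V`, and the Christoffel terms cancel. -/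
theorem bochner_algebra {F1 F2 F11 F12 F22 V1 V2 V11 V12 V22 VG : E n}
    {α β s t b₁₁₁ b₁₁₂ b₁₂₁ b₁₂₂ b₂₂₁ b₂₂₂ : ℝ} {B11 B12 B22 : E n}
    (h11 : inner ℝ F1 F1 = (1 : ℝ)) (h12 : inner ℝ F1 F2 = (0 : ℝ)) (h22 : inner ℝ F2 F2 = (1 : ℝ))
    (hB1 : inner ℝ B11 F1 = (0 : ℝ)) (hB2 : inner ℝ B11 F2 = (0 : ℝ))
    (hB3 : inner ℝ B12 F1 = (0 : ℝ)) (hB4 : inner ℝ B12 F2 = (0 : ℝ))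
    (hB5 : inner ℝ B22 F1 = (0 : ℝ)) (hB6 : inner ℝ B22 F2 = (0 : ℝ))
    (hF11 : F11 = b₁₁₁ • F1 + b₁₁₂ • F2 + B11)
    (hF12 : F12 = b₁₂₁ • F1 + b₁₂₂ • F2 + B12)
    (hF22 : F22 = b₂₂₁ • F1 + b₂₂₂ • F2 + B22)
    (hV1 : V1 = s • F1 + t • F2 + (α • B11 + β • B12))
    (hV2 : V2 = t • F1 - s • F2 + (α • B12 + β • B22))
    (hVG : VG = (b₁₁₁ + b₂₂₁) • V1 + (b₁₁₂ + b₂₂₂) • V2)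
    (hc1 : inner ℝ V11 F2 + inner ℝ V1 F12 = inner ℝ V12 F1 + inner ℝ V2 F11)
    (hc2 : inner ℝ V12 F2 + inner ℝ V1 F22 = inner ℝ V22 F1 + inner ℝ V2 F12)
    (hd1 : inner ℝ V11 F1 + inner ℝ V1 F11 + (inner ℝ V12 F2 + inner ℝ V2 F12)
      + 2 * inner ℝ F12 F2 * s - 2 * inner ℝ F11 F1 * s
      - 2 * (inner ℝ F11 F2 + inner ℝ F12 F1) * t = 0)
    (hd2 : inner ℝ V12 F1 + inner ℝ V1 F12 + (inner ℝ V22 F2 + inner ℝ V2 F22)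
      + 2 * inner ℝ F22 F2 * s - 2 * inner ℝ F12 F1 * s
      - 2 * (inner ℝ F12 F2 + inner ℝ F22 F1) * t = 0) :
    inner ℝ (α • F1 + β • F2) (V11 + V22 - VG)
      = (inner ℝ B11 B22 - inner ℝ B12 B12) * (α ^ 2 + β ^ 2)
        - inner ℝ (α • B11 + β • B12) (α • B11 + β • B12)
        - inner ℝ (α • B12 + β • B22) (α • B12 + β • B22) := by
  have h21 : inner ℝ F2 F1 = (0 : ℝ) := by rw [real_inner_comm]; exact h12
  have hB1' : inner ℝ F1 B11 = (0 : ℝ) := by rw [real_inner_comm]; exact hB1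
  have hB2' : inner ℝ F2 B11 = (0 : ℝ) := by rw [real_inner_comm]; exact hB2
  have hB3' : inner ℝ F1 B12 = (0 : ℝ) := by rw [real_inner_comm]; exact hB3
  have hB4' : inner ℝ F2 B12 = (0 : ℝ) := by rw [real_inner_comm]; exact hB4
  have hB5' : inner ℝ F1 B22 = (0 : ℝ) := by rw [real_inner_comm]; exact hB5
  have hB6' : inner ℝ F2 B22 = (0 : ℝ) := by rw [real_inner_comm]; exact hB6
  have c1 : inner ℝ B12 B11 = (inner ℝ B11 B12 : ℝ) := real_inner_comm _ _
  have c2 : inner ℝ B22 B11 = (inner ℝ B11 B22 : ℝ) := real_inner_comm _ _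
  have c3 : inner ℝ B22 B12 = (inner ℝ B12 B22 : ℝ) := real_inner_comm _ _
  have d1 : inner ℝ F1 V11 = (inner ℝ V11 F1 : ℝ) := real_inner_comm _ _
  have d2 : inner ℝ F2 V11 = (inner ℝ V11 F2 : ℝ) := real_inner_comm _ _
  have d3 : inner ℝ F1 V22 = (inner ℝ V22 F1 : ℝ) := real_inner_comm _ _
  have d4 : inner ℝ F2 V22 = (inner ℝ V22 F2 : ℝ) := real_inner_comm _ _
  subst hVG hF11 hF12 hF22 hV1 hV2
  simp only [inner_add_left, inner_add_right, inner_sub_left, inner_sub_right, inner_smul_left,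
    inner_smul_right, h11, h12, h22, h21, hB1, hB2, hB3, hB4, hB5, hB6, hB1', hB2', hB3', hB4',
    hB5', hB6', c1, c2, c3, d1, d2, d3, d4, conj_trivial] at hc1 hc2 hd1 hd2 ⊢
  linear_combination α * (hd1 - hc2) + β * (hd2 + hc1)

end Bochner

section Harmonic

variable {m n : ℕ}

/-- The tangent field `V` of the immersed surface `F`, read in coordinates, satisfies the equations
of a harmonic field at `z`: the bilinear form `T(a, b) = ⟨D_a V, DF b⟩`, i.e. `⟨∇_a V, b⟩`, is
symmetric and trace-free for the induced metric `g`. The trace condition is written as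
`g_bb T_aa - g_ab (T_ab + T_ba) + g_aa T_bb = 0` for all `a`, `b`, which avoids `g⁻¹` and is easy to
differentiate. -/
structure IsCoordHarmonic (F V : E 2 → E n) (z : E 2) : Prop where
  closed : ∀ a b, (inner ℝ (fderiv ℝ V z a) (fderiv ℝ F z b) : ℝ)
    = inner ℝ (fderiv ℝ V z b) (fderiv ℝ F z a)
  coclosed : ∀ a b,
    inner ℝ (fderiv ℝ F z b) (fderiv ℝ F z b) * (inner ℝ (fderiv ℝ V z a) (fderiv ℝ F z a) : ℝ)
    - inner ℝ (fderiv ℝ F z a) (fderiv ℝ F z b) * (inner ℝ (fderiv ℝ V z a) (fderiv ℝ F z b)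
        + inner ℝ (fderiv ℝ V z b) (fderiv ℝ F z a))
    + inner ℝ (fderiv ℝ F z a) (fderiv ℝ F z a) * inner ℝ (fderiv ℝ V z b) (fderiv ℝ F z b) = 0

/-- Bochner's formula `⟨V, ΔV⟩ = K |V|² - ∑ |B(e_i, V)|²` for the `ℝⁿ`-valued Laplacian of a harmonic
field `V` on an immersed surface, where `B` is the second fundamental form in `ℝⁿ` and
`K = ⟨B₁₁, B₂₂⟩ - |B₁₂|²` is the Gauss curvature. The vector `γ` is the trace of the Christoffel
symbols. -/
theorem bochner {F : E 2 → E n} {x : E 2 → E 2} {y : E 2} {e : Fin 2 → E 2} {γ : E 2}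
    {V : E 2 → E n} (hVdef : V = fun z => fderiv ℝ F z (x z))
    {B : E 2 → E 2 → E n}
    (hBdef : B = fun a b => normalPart (fun i => fderiv ℝ F y (e i)) (D2 F y a b))
    (hF : ContDiffAt ℝ ∞ F y) (hx : ContDiffAt ℝ ∞ x y)
    (he : ∀ i j, inner ℝ (fderiv ℝ F y (e i)) (fderiv ℝ F y (e j)) = if i = j then (1 : ℝ) else 0)
    (hγ : ∀ w, (inner ℝ (fderiv ℝ F y γ) (fderiv ℝ F y w) : ℝ)
      = inner ℝ (D2 F y (e 0) (e 0) + D2 F y (e 1) (e 1)) (fderiv ℝ F y w))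
    (hV : ∀ᶠ z in 𝓝 y, IsCoordHarmonic F V z) :
    inner ℝ (V y) (D2 V y (e 0) (e 0) + D2 V y (e 1) (e 1) - fderiv ℝ V y γ)
      = (inner ℝ (B (e 0) (e 0)) (B (e 1) (e 1)) - inner ℝ (B (e 0) (e 1)) (B (e 0) (e 1)))
          * inner ℝ (V y) (V y)
        - inner ℝ (B (e 0) (x y)) (B (e 0) (x y)) - inner ℝ (B (e 1) (x y)) (B (e 1) (x y)) := by
  have hVs : ContDiffAt ℝ ∞ V y := hVdef ▸ contDiffAt_fderiv_apply hF hx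
  have hVd : ∀ b, DifferentiableAt ℝ (fun z => fderiv ℝ V z b) y := fun b =>
    (contDiffAt_fderiv_apply hVs contDiffAt_const).differentiableAt (by simp)
  have hFd : ∀ b, DifferentiableAt ℝ (fun z => fderiv ℝ F z b) y := fun b =>
    (contDiffAt_fderiv_apply hF contDiffAt_const).differentiableAt (by simp)
  set u : Fin 2 → E n := fun i => fderiv ℝ F y (e i) with hu
  have huo : Orthonormal ℝ u := by rw [orthonormal_iff_ite]; exact he
  -- the differentiated closedness condition
  have dT : ∀ a b c, HasFDerivAt (fun z => (inner ℝ (fderiv ℝ V z a) (fderiv ℝ F z b) : ℝ))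
      (fderiv ℝ (fun z => (inner ℝ (fderiv ℝ V z a) (fderiv ℝ F z b) : ℝ)) y) y ∧
      fderiv ℝ (fun z => (inner ℝ (fderiv ℝ V z a) (fderiv ℝ F z b) : ℝ)) y c
      = inner ℝ (D2 V y c a) (fderiv ℝ F y b) + inner ℝ (fderiv ℝ V y a) (D2 F y c b) := by
    intro a b c
    refine ⟨(differentiableAt_inner_fderiv hF (hVd a) b).hasFDerivAt, ?_⟩
    rw [fderiv_inner_fderiv hF (hVd a), fderiv_fderiv_apply hVs]
  have dg : ∀ a b c, HasFDerivAt (fun z => (inner ℝ (fderiv ℝ F z a) (fderiv ℝ F z b) : ℝ))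
      (fderiv ℝ (fun z => (inner ℝ (fderiv ℝ F z a) (fderiv ℝ F z b) : ℝ)) y) y ∧
      fderiv ℝ (fun z => (inner ℝ (fderiv ℝ F z a) (fderiv ℝ F z b) : ℝ)) y c
      = inner ℝ (D2 F y c a) (fderiv ℝ F y b) + inner ℝ (fderiv ℝ F y a) (D2 F y c b) := by
    intro a b c
    refine ⟨(differentiableAt_inner_fderiv hF (hFd a) b).hasFDerivAt, ?_⟩
    rw [fderiv_inner_fderiv hF (hFd a), fderiv_fderiv_apply hF]
  have hc : ∀ c, (inner ℝ (D2 V y c (e 0)) (u 1) + inner ℝ (fderiv ℝ V y (e 0)) (D2 F y c (e 1)) : ℝ)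
      = inner ℝ (D2 V y c (e 1)) (u 0) + inner ℝ (fderiv ℝ V y (e 1)) (D2 F y c (e 0)) := by
    intro c
    rw [← (dT (e 0) (e 1) c).2, ← (dT (e 1) (e 0) c).2]
    have : (fun z => (inner ℝ (fderiv ℝ V z (e 0)) (fderiv ℝ F z (e 1)) : ℝ))
        =ᶠ[𝓝 y] (fun z => (inner ℝ (fderiv ℝ V z (e 1)) (fderiv ℝ F z (e 0)) : ℝ)) := by
      filter_upwards [hV] with z hz using hz.closed _ _
    rw [this.fderiv_eq]
  have hVy := hV.self_of_nhds
  have g11 : inner ℝ (fderiv ℝ F y (e 0)) (fderiv ℝ F y (e 0)) = (1 : ℝ) := by simpa using he 0 0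
  have g12 : inner ℝ (fderiv ℝ F y (e 0)) (fderiv ℝ F y (e 1)) = (0 : ℝ) := by simpa using he 0 1
  have g22 : inner ℝ (fderiv ℝ F y (e 1)) (fderiv ℝ F y (e 1)) = (1 : ℝ) := by simpa using he 1 1
  obtain ⟨s, hs⟩ : ∃ s : ℝ, s = inner ℝ (fderiv ℝ V y (e 0)) (fderiv ℝ F y (e 0)) := ⟨_, rfl⟩
  obtain ⟨t, ht⟩ : ∃ t : ℝ, t = inner ℝ (fderiv ℝ V y (e 0)) (fderiv ℝ F y (e 1)) := ⟨_, rfl⟩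
  have ht' : inner ℝ (fderiv ℝ V y (e 1)) (fderiv ℝ F y (e 0)) = t := by
    rw [ht]; exact hVy.closed _ _
  have hs' : inner ℝ (fderiv ℝ V y (e 1)) (fderiv ℝ F y (e 1)) = -s := by
    have := hVy.coclosed (e 0) (e 1)
    rw [g11, g12, g22, ← hs] at this
    linarith
  have hd : ∀ c, (inner ℝ (D2 V y c (e 0)) (u 0) + inner ℝ (fderiv ℝ V y (e 0)) (D2 F y c (e 0))
      + (inner ℝ (D2 V y c (e 1)) (u 1) + inner ℝ (fderiv ℝ V y (e 1)) (D2 F y c (e 1)))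
      + 2 * inner ℝ (D2 F y c (e 1)) (u 1) * s - 2 * inner ℝ (D2 F y c (e 0)) (u 0) * s
      - 2 * (inner ℝ (D2 F y c (e 0)) (u 1) + inner ℝ (D2 F y c (e 1)) (u 0)) * t : ℝ) = 0 := by
    intro c
    have h0 : (fun z => inner ℝ (fderiv ℝ F z (e 1)) (fderiv ℝ F z (e 1))
          * (inner ℝ (fderiv ℝ V z (e 0)) (fderiv ℝ F z (e 0)) : ℝ)
        - inner ℝ (fderiv ℝ F z (e 0)) (fderiv ℝ F z (e 1))
          * (inner ℝ (fderiv ℝ V z (e 0)) (fderiv ℝ F z (e 1))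
            + inner ℝ (fderiv ℝ V z (e 1)) (fderiv ℝ F z (e 0)))
        + inner ℝ (fderiv ℝ F z (e 0)) (fderiv ℝ F z (e 0))
          * inner ℝ (fderiv ℝ V z (e 1)) (fderiv ℝ F z (e 1))) =ᶠ[𝓝 y] fun _ => 0 := by
      filter_upwards [hV] with z hz using hz.coclosed (e 0) (e 1)
    have h1 := ((((dg (e 1) (e 1) c).1.mul (dT (e 0) (e 0) c).1).sub
      ((dg (e 0) (e 1) c).1.mul ((dT (e 0) (e 1) c).1.add (dT (e 1) (e 0) c).1))).add
      ((dg (e 0) (e 0) c).1.mul (dT (e 1) (e 1) c).1)).fderiv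
    have h2 := congrArg (fun L => L c) (h1.symm.trans (h0.fderiv_eq.trans
      (by simp : fderiv ℝ (fun _ : E 2 => (0 : ℝ)) y = 0)))
    simp only [add_apply, sub_apply,
      smul_apply, smul_eq_mul, (dg _ _ c).2, (dT _ _ c).2, g11, g12, g22,
      ← hs, ← ht, ht', hs', Pi.add_apply, zero_apply] at h2
    have k1 : (inner ℝ (fderiv ℝ F y (e 1)) (D2 F y c (e 1)) : ℝ)
      = inner ℝ (D2 F y c (e 1)) (fderiv ℝ F y (e 1)) := real_inner_comm _ _
    have k2 : (inner ℝ (fderiv ℝ F y (e 0)) (D2 F y c (e 1)) : ℝ)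
      = inner ℝ (D2 F y c (e 1)) (fderiv ℝ F y (e 0)) := real_inner_comm _ _
    have k3 : (inner ℝ (fderiv ℝ F y (e 0)) (D2 F y c (e 0)) : ℝ)
      = inner ℝ (D2 F y c (e 0)) (fderiv ℝ F y (e 0)) := real_inner_comm _ _
    rw [k1, k2, k3] at h2
    simp only [hu]
    linear_combination h2
  obtain ⟨α, β, hαβ⟩ := exists_coords_of_orthonormal (fderiv ℝ F y) e he (x y)
  obtain ⟨γ₁, γ₂, hγ12⟩ := exists_coords_of_orthonormal (fderiv ℝ F y) e he γ
  have hVy' : V y = α • u 0 + β • u 1 := by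
    rw [hVdef]
    simp only [hαβ]; simp [hu]
  have hBx : ∀ i, B (e i) (x y) = α • B (e i) (e 0) + β • B (e i) (e 1) := by
    intro i
    simp only [hBdef]
    rw [hαβ, D2_add_right, D2_smul_right, D2_smul_right, normalPart_add, normalPart_smul,
      normalPart_smul]
  have hBc : B (e 1) (e 0) = B (e 0) (e 1) := by simp only [hBdef]; rw [D2_comm hF]
  have hn : ∀ c, normalPart u (fderiv ℝ F y c) = 0 := fun c => normalPart_map he c
  have hVn : ∀ i, normalPart u (fderiv ℝ V y (e i)) = B (e i) (x y) := by
    intro i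
    simp only [hVdef, hBdef]
    rw [fderiv_fderiv_field hF hx, normalPart_add, hn, add_zero]
  have hγu : ∀ i, (inner ℝ (fderiv ℝ F y γ) (u i) : ℝ)
      = inner ℝ (D2 F y (e 0) (e 0)) (u i) + inner ℝ (D2 F y (e 1) (e 1)) (u i) := by
    intro i
    rw [← inner_add_left]; exact hγ (e i)
  have hγ1 : γ₁ = inner ℝ (D2 F y (e 0) (e 0)) (u 0) + inner ℝ (D2 F y (e 1) (e 1)) (u 0) := by
    rw [← hγu, hγ12]
    simp only [hu, map_add, map_smul, inner_add_left, inner_smul_left, he]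
    simp
  have hγ2 : γ₂ = inner ℝ (D2 F y (e 0) (e 0)) (u 1) + inner ℝ (D2 F y (e 1) (e 1)) (u 1) := by
    rw [← hγu, hγ12]
    simp only [hu, map_add, map_smul, inner_add_left, inner_smul_left, he]
    simp
  have hBn : ∀ a b i, (inner ℝ (B a b) (u i) : ℝ) = 0 := by
    intro a b i
    rw [hBdef]; exact inner_normalPart huo _ i
  have hBe : ∀ a b, D2 F y a b
      = (inner ℝ (D2 F y a b) (u 0) : ℝ) • u 0 + (inner ℝ (D2 F y a b) (u 1) : ℝ) • u 1 + B a b := by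
    intro a b
    rw [hBdef]; exact eq_add_normalPart_two u _
  have key := bochner_algebra (F1 := u 0) (F2 := u 1) (V1 := fderiv ℝ V y (e 0))
    (V2 := fderiv ℝ V y (e 1)) (V11 := D2 V y (e 0) (e 0)) (V12 := D2 V y (e 0) (e 1))
    (V22 := D2 V y (e 1) (e 1)) (VG := fderiv ℝ V y γ) (α := α) (β := β) (s := s) (t := t)
    (B11 := B (e 0) (e 0)) (B12 := B (e 0) (e 1)) (B22 := B (e 1) (e 1))
    g11 g12 g22 (hBn _ _ 0) (hBn _ _ 1)
    (hBn _ _ 0) (hBn _ _ 1)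
    (hBn _ _ 0) (hBn _ _ 1)
    (hBe _ _) (hBe _ _) (hBe _ _)
    (by
      rw [← hBx 0, ← hVn 0, hs, ht]
      exact eq_add_normalPart_two u _)
    (by
      have := eq_add_normalPart_two u (fderiv ℝ V y (e 1))
      simp only [hu, ht', hs'] at this
      rw [← hBc, ← hBx 1, ← hVn 1]
      simp only [hu]
      rw [sub_eq_add_neg, ← neg_smul]
      exact this)
    (by rw [hγ12, map_add, map_smul, map_smul, hγ1, hγ2])
    (hc (e 0)) (by simpa only [D2_comm hVs (e 1) (e 0), D2_comm hF (e 1) (e 0)] using hc (e 1))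
    (hd (e 0)) (by simpa only [D2_comm hVs (e 1) (e 0), D2_comm hF (e 1) (e 0)] using hd (e 1))
  rw [hVy', key, hBx 0, hBx 1, hBc]
  congr 3
  simp only [inner_add_left, inner_add_right, inner_smul_left, inner_smul_right, hu, he,
    conj_trivial]
  simp
  ring

end Harmonic

/-! ### Complex structures on surfaces -/

section Complex

variable {n : ℕ}

/-- A nonzero vector and its image under a complex structure span the plane. -/
lemma exists_coords_of_complex (j : E 2 →L[ℝ] E 2) (hj : ∀ a, j (j a) = -a) {x : E 2} (hx : x ≠ 0)
    (v : E 2) : ∃ α β : ℝ, v = α • x + β • j x := by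
  have hli : LinearIndependent ℝ ![x, j x] := by
    rw [LinearIndependent.pair_iff]
    intro s t hst
    have h2 : s • j x - t • x = 0 := by
      have := congrArg j hst
      simpa [hj, sub_eq_add_neg] using this
    have h3 : (s ^ 2 + t ^ 2) • x = 0 := by
      have : (s ^ 2 + t ^ 2) • x = s • (s • x + t • j x) - t • (s • j x - t • x) := by module
      rw [this, hst, h2]; simp
    have h4 : s ^ 2 + t ^ 2 = 0 := (smul_eq_zero.1 h3).resolve_right hx
    constructor <;> nlinarith [sq_nonneg s, sq_nonneg t]
  let b := basisOfLinearIndependentOfCardEqFinrank hli (by simp)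
  refine ⟨b.repr v 0, b.repr v 1, ?_⟩
  have := b.sum_repr v
  rw [Fin.sum_univ_two] at this
  simpa [b] using this.symm

/-- A metric complex structure on a surface is parallel: `⟨∇_c (j x), b⟩ = -⟨∇_c x, j b⟩`. Where
`x ≠ 0` it is enough to test on `b = x` and `b = j x`, i.e. to differentiate `⟨j x, x⟩ = 0` and
`|j x|² = |x|²`; where `x = 0` the derivative of `j` does not contribute. -/
lemma inner_fderiv_complex {F : E 2 → E n} {x : E 2 → E 2} {j : E 2 → E 2 →L[ℝ] E 2} {y : E 2}
    (hF : ContDiffAt ℝ ∞ F y) (hx : ContDiffAt ℝ ∞ x y) (hjs : ContDiffAt ℝ ∞ j y)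
    (hj : ∀ᶠ z in 𝓝 y, ∀ a, j z (j z a) = -a)
    (hskew : ∀ᶠ z in 𝓝 y, ∀ a b, (inner ℝ (fderiv ℝ F z (j z a)) (fderiv ℝ F z b) : ℝ)
      = -inner ℝ (fderiv ℝ F z a) (fderiv ℝ F z (j z b))) (c b : E 2) :
    (inner ℝ (fderiv ℝ (fun z => fderiv ℝ F z (j z (x z))) y c) (fderiv ℝ F y b) : ℝ)
      = -inner ℝ (fderiv ℝ (fun z => fderiv ℝ F z (x z)) y c) (fderiv ℝ F y (j y b)) := by
  have hjx : ContDiffAt ℝ ∞ (fun z => j z (x z)) y := hjs.clm_apply hx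
  by_cases h0 : x y = 0
  · have h1 : fderiv ℝ (fun z => j z (x z)) y c = j y (fderiv ℝ x y c) := by
      rw [fderiv_clm_apply (hjs.differentiableAt (by simp)) (hx.differentiableAt (by simp))]
      simp [h0]
    rw [fderiv_fderiv_field hF hjx, fderiv_fderiv_field hF hx, h1, h0]
    simpa [D2] using hskew.self_of_nhds (fderiv ℝ x y c) b
  · set V : E 2 → E n := fun z => fderiv ℝ F z (x z) with hV
    set P : E 2 → E n := fun z => fderiv ℝ F z (j z (x z)) with hP
    have hVd : DifferentiableAt ℝ V y := (contDiffAt_fderiv_apply hF hx).differentiableAt (by simp)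
    have hPd : DifferentiableAt ℝ P y := (contDiffAt_fderiv_apply hF hjx).differentiableAt (by simp)
    have e1 : (fun z => (inner ℝ (P z) (V z) : ℝ)) =ᶠ[𝓝 y] fun _ => 0 := by
      filter_upwards [hskew] with z hz
      have := hz (x z) (x z)
      rw [real_inner_comm (fderiv ℝ F z (j z (x z))) (fderiv ℝ F z (x z))] at this
      simp only [hP, hV]
      linarith
    have e2 : (fun z => (inner ℝ (P z) (P z) : ℝ)) =ᶠ[𝓝 y] fun z => (inner ℝ (V z) (V z) : ℝ) := by
      filter_upwards [hskew, hj] with z hz hz'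
      have := hz (x z) (j z (x z))
      rw [hz', map_neg, inner_neg_right, neg_neg] at this
      exact this
    have d1 := congrArg (fun L => L c) (e1.fderiv_eq (𝕜 := ℝ))
    have d2 := congrArg (fun L => L c) (e2.fderiv_eq (𝕜 := ℝ))
    simp only [fderiv_inner_apply ℝ hPd hVd, fderiv_inner_apply ℝ hPd hPd,
      fderiv_inner_apply ℝ hVd hVd] at d1 d2
    rw [real_inner_comm (fderiv ℝ P y c) (P y), real_inner_comm (fderiv ℝ V y c) (V y)] at d2
    rw [real_inner_comm (fderiv ℝ V y c) (P y)] at d1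
    simp at d1
    have hjy := hj.self_of_nhds
    obtain ⟨α, β, hαβ⟩ := exists_coords_of_complex (j y) hjy h0 b
    have f1 : fderiv ℝ F y b = α • V y + β • P y := by rw [hαβ]; simp [hV, hP]
    have f2 : fderiv ℝ F y (j y b) = α • P y - β • V y := by
      rw [hαβ]; simp [hV, hP, hjy, sub_eq_add_neg]
    rw [f1, f2]
    simp only [inner_add_right, inner_sub_right, inner_smul_right]
    linear_combination α * d1 + β / 2 * d2

/-- If `V` is harmonic, so is the field `P = J V`. -/
lemma IsCoordHarmonic.complex {F V P : E 2 → E n} {z : E 2} {j : E 2 →L[ℝ] E 2}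
    (hinj : ∀ a, fderiv ℝ F z a = 0 → a = 0)
    (hj : ∀ a, j (j a) = -a)
    (hskew : ∀ a b, (inner ℝ (fderiv ℝ F z (j a)) (fderiv ℝ F z b) : ℝ)
      = -inner ℝ (fderiv ℝ F z a) (fderiv ℝ F z (j b)))
    (hVP : ∀ c b, (inner ℝ (fderiv ℝ P z c) (fderiv ℝ F z b) : ℝ)
      = -inner ℝ (fderiv ℝ V z c) (fderiv ℝ F z (j b)))
    (h : IsCoordHarmonic F V z) : IsCoordHarmonic F P z := by
  -- on the orthogonal frame `a, j a` the trace-free symmetric form `T` satisfies these relations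
  have tr : ∀ a, (inner ℝ (fderiv ℝ V z (j a)) (fderiv ℝ F z (j a)) : ℝ)
      = - inner ℝ (fderiv ℝ V z a) (fderiv ℝ F z a) := by
    intro a
    by_cases ha : a = 0
    · simp [ha]
    have h1 : (inner ℝ (fderiv ℝ F z a) (fderiv ℝ F z (j a)) : ℝ) = 0 := by
      have := hskew a a
      rw [real_inner_comm] at this
      linarith
    have h2 : (inner ℝ (fderiv ℝ F z (j a)) (fderiv ℝ F z (j a)) : ℝ)
        = inner ℝ (fderiv ℝ F z a) (fderiv ℝ F z a) := by
      rw [hskew, hj, map_neg, inner_neg_right, neg_neg]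
    have h3 : (inner ℝ (fderiv ℝ F z a) (fderiv ℝ F z a) : ℝ) ≠ 0 := by
      rw [Ne, inner_self_eq_zero]; exact fun h => ha (hinj a h)
    have := h.coclosed a (j a)
    rw [h1, h2] at this
    have h4 : (inner ℝ (fderiv ℝ F z a) (fderiv ℝ F z a) : ℝ)
      * (inner ℝ (fderiv ℝ V z a) (fderiv ℝ F z a)
        + inner ℝ (fderiv ℝ V z (j a)) (fderiv ℝ F z (j a))) = 0 := by linear_combination this
    have := (mul_eq_zero.1 h4).resolve_left h3
    linarith
  have tr2 : ∀ a b, (inner ℝ (fderiv ℝ V z (j a)) (fderiv ℝ F z (j b)) : ℝ)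
      = - inner ℝ (fderiv ℝ V z a) (fderiv ℝ F z b) := by
    intro a b
    have h1 := tr (a + b)
    simp only [map_add, inner_add_left, inner_add_right] at h1
    have h2 := h.closed (j a) (j b)
    have h3 := h.closed a b
    linarith [tr a, tr b]
  have sym : ∀ a b, (inner ℝ (fderiv ℝ V z a) (fderiv ℝ F z (j b)) : ℝ)
      = inner ℝ (fderiv ℝ V z b) (fderiv ℝ F z (j a)) := by
    intro a b
    have := tr2 a (j b)
    rw [hj, map_neg, inner_neg_right] at this
    rw [← h.closed (j a) b]; linarith
  refine ⟨fun a b => by rw [hVP, hVP, sym], fun a b => ?_⟩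
  by_cases ha : a = 0
  · simp [ha]
  obtain ⟨α, β, hb⟩ := exists_coords_of_complex j hj ha b
  have h1 : (inner ℝ (fderiv ℝ F z a) (fderiv ℝ F z (j a)) : ℝ) = 0 := by
    have := hskew a a
    rw [real_inner_comm] at this
    linarith
  have h1' : (inner ℝ (fderiv ℝ F z (j a)) (fderiv ℝ F z a) : ℝ) = 0 := by
    rw [real_inner_comm]; exact h1
  have h2 : (inner ℝ (fderiv ℝ F z (j a)) (fderiv ℝ F z (j a)) : ℝ)
      = inner ℝ (fderiv ℝ F z a) (fderiv ℝ F z a) := by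
    rw [hskew, hj, map_neg, inner_neg_right, neg_neg]
  simp only [hVP, hb, map_add, map_smul, hj, map_neg, inner_add_left, inner_add_right,
    inner_smul_left, inner_smul_right, inner_neg_right, h1, h1', h2, h.closed (j a) a, tr,
    conj_trivial]
  ring

end Complex

/-! ### Charts and coordinates -/

section Charts

variable {m n : ℕ} {M : Type*} [TopologicalSpace M] [ChartedSpace (E m) M] [IsManifold (𝓡 m) ∞ M]
  {W : Type*} [NormedAddCommGroup W] [NormedSpace ℝ W]

omit [IsManifold (𝓡 m) ∞ M] in
lemma base_mem_target (p : M) : base p ∈ (extChartAt (𝓡 m) p).target :=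
  mem_extChartAt_target p

omit [IsManifold (𝓡 m) ∞ M] in
lemma isOpen_chart_target (p : M) : IsOpen (extChartAt (𝓡 m) p).target :=
  isOpen_extChartAt_target p

omit [IsManifold (𝓡 m) ∞ M] in
lemma chart_target_mem_nhds {p : M} {y : E m} (hy : y ∈ (extChartAt (𝓡 m) p).target) :
    (extChartAt (𝓡 m) p).target ∈ 𝓝 y := (isOpen_chart_target p).mem_nhds hy

omit [IsManifold (𝓡 m) ∞ M] in
lemma symm_base (p : M) : (extChartAt (𝓡 m) p).symm (base p) = p :=
  extChartAt_to_inv p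

lemma toChart_fromChart {p : M} {y : E m} (hy : y ∈ (extChartAt (𝓡 m) p).target) (a : E m) :
    toChart p ((extChartAt (𝓡 m) p).symm y) (fromChart p y a) = a := by
  have h := mfderiv_extChartAt_comp_mfderivWithin_extChartAt_symm (I := 𝓡 m) hy
  have hr : Set.range (𝓡 m) = Set.univ := by simp
  rw [hr, mfderivWithin_univ] at h
  exact congrArg (fun L => L a) h

lemma fromChart_toChart {p : M} {y : E m} (hy : y ∈ (extChartAt (𝓡 m) p).target)
    (v : TangentSpace (𝓡 m) ((extChartAt (𝓡 m) p).symm y)) :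
    fromChart p y (toChart p ((extChartAt (𝓡 m) p).symm y) v) = v := by
  have h := mfderivWithin_extChartAt_symm_comp_mfderiv_extChartAt (I := 𝓡 m) hy
  have hr : Set.range (𝓡 m) = Set.univ := by simp
  rw [hr, mfderivWithin_univ] at h
  exact congrArg (fun L => L v) h

lemma toChart_self (p : M) (v : TangentSpace (𝓡 m) p) : toChart p p v = v := by
  have h := mfderiv_extChartAt_self (I := 𝓡 m) (x := p)
  exact congrArg (fun L => L v) h

lemma contDiffAt_comp_symm {u : M → W} (hu : ContMDiff (𝓡 m) 𝓘(ℝ, W) ∞ u) {p : M} {y : E m}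
    (hy : y ∈ (extChartAt (𝓡 m) p).target) :
    ContDiffAt ℝ ∞ (u ∘ (extChartAt (𝓡 m) p).symm) y := by
  have h := hu.comp_contMDiffOn (contMDiffOn_extChartAt_symm (I := 𝓡 m) (n := ∞) p)
  exact (contMDiffOn_iff_contDiffOn.1 h).contDiffAt (chart_target_mem_nhds hy)

lemma mdifferentiableAt_symm {p : M} {y : E m} (hy : y ∈ (extChartAt (𝓡 m) p).target) :
    MDifferentiableAt 𝓘(ℝ, E m) (𝓡 m) (extChartAt (𝓡 m) p).symm y := by
  have h := mdifferentiableWithinAt_extChartAt_symm (I := 𝓡 m) hy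
  have hr : Set.range (𝓡 m) = Set.univ := by simp
  rwa [hr, mdifferentiableWithinAt_univ] at h

lemma fderiv_comp_symm {u : M → W} {p : M} {y : E m}
    (hu : MDifferentiableAt (𝓡 m) 𝓘(ℝ, W) u ((extChartAt (𝓡 m) p).symm y))
    (hy : y ∈ (extChartAt (𝓡 m) p).target) (a : E m) :
    fderiv ℝ (u ∘ (extChartAt (𝓡 m) p).symm) y a
      = mvfderiv (𝓡 m) u ((extChartAt (𝓡 m) p).symm y) (fromChart p y a) := by
  rw [← mfderiv_eq_fderiv, mfderiv_comp y hu (mdifferentiableAt_symm hy)]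
  rfl

/-- Since the chart at `p` has derivative `id` at `p`, derivatives at `p` are derivatives in that
chart. -/
lemma mvfderiv_eq_fderiv_base {u : M → W} {p : M} (hu : MDifferentiableAt (𝓡 m) 𝓘(ℝ, W) u p)
    (v : TangentSpace (𝓡 m) p) :
    mvfderiv (𝓡 m) u p v = fderiv ℝ (u ∘ (extChartAt (𝓡 m) p).symm) (base p) v := by
  have hs := symm_base (m := m) p
  have hy := base_mem_target (m := m) p
  have key : ∀ q (hq : q = p), MDifferentiableAt (𝓡 m) 𝓘(ℝ, W) u q := by
    intro q hq; rw [hq]; exact hu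
  have h1 : MDifferentiableAt 𝓘(ℝ, E m) 𝓘(ℝ, W) (u ∘ (extChartAt (𝓡 m) p).symm) (base p) :=
    MDifferentiableAt.comp (base p) (key _ hs) (mdifferentiableAt_symm hy)
  have h2 : MDifferentiableAt (𝓡 m) 𝓘(ℝ, E m) (extChartAt (𝓡 m) p) p :=
    mdifferentiableAt_extChartAt (mem_chart_source _ p)
  have h3 : u =ᶠ[𝓝 p] (u ∘ (extChartAt (𝓡 m) p).symm) ∘ extChartAt (𝓡 m) p := by
    filter_upwards [extChartAt_source_mem_nhds (I := 𝓡 m) p] with q hq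
    exact congrArg u ((extChartAt (𝓡 m) p).left_inv hq).symm
  have h4 : mfderiv (𝓡 m) 𝓘(ℝ, W) u p = _ := h3.mfderiv_eq
  have h5 := mfderiv_comp (I' := 𝓘(ℝ, E m)) (f := extChartAt (𝓡 m) p) p h1 h2
  have h6 : mfderiv (𝓡 m) 𝓘(ℝ, W) u p v
      = mfderiv 𝓘(ℝ, E m) 𝓘(ℝ, W) (u ∘ (extChartAt (𝓡 m) p).symm) (base p) (toChart p p v) := by
    rw [h4, h5]; rfl
  rw [toChart_self, mfderiv_eq_fderiv] at h6
  exact h6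

end Charts

section Coordinates

variable {m n : ℕ}

lemma sum_smul_stdVec (a : E m) : ∑ i, a i • (stdVec i : E m) = a := by
  have := (EuclideanSpace.basisFun (Fin m) ℝ).sum_repr a
  simpa [stdVec] using this

lemma clm_apply_eq_sum {W : Type*} [NormedAddCommGroup W] [NormedSpace ℝ W] (L : E m →L[ℝ] W)
    (a : E m) : L a = ∑ i, a i • L (stdVec i) := by
  conv_lhs => rw [← sum_smul_stdVec a]
  simp [map_sum]

lemma D2_eq_sum {W : Type*} [NormedAddCommGroup W] [NormedSpace ℝ W] (F : E m → W)
    (y a b : E m) : D2 F y a b = ∑ i, ∑ j, (a i * b j) • D2 F y (stdVec i) (stdVec j) := by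
  conv_lhs => rw [← sum_smul_stdVec a, ← sum_smul_stdVec b, D2_sum_left]
  refine Finset.sum_congr rfl fun i _ => ?_
  rw [D2_smul_left, D2_sum_right, Finset.smul_sum]
  refine Finset.sum_congr rfl fun j _ => ?_
  rw [D2_smul_right, smul_smul]

/-- If the vectors `f_a` are orthonormal for the inner product with matrix `A`, then
`A⁻¹ = ∑ f_a f_aᵀ`. -/
lemma gram_inv_eq_sum {A : Matrix (Fin m) (Fin m) ℝ} {f : Fin m → E m}
    (hf : ∀ a b, ∑ i, ∑ j, f a i * A i j * f b j = if a = b then (1 : ℝ) else 0) (i j : Fin m) :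
    A⁻¹ i j = ∑ a, f a i * f a j := by
  set P : Matrix (Fin m) (Fin m) ℝ := Matrix.of fun i a => f a i with hP
  have h1 : P.transpose * (A * P) = 1 := by
    ext a b
    rw [Matrix.one_apply, ← hf a b, Matrix.mul_apply]
    refine Finset.sum_congr rfl fun i _ => ?_
    rw [Matrix.mul_apply, Finset.mul_sum]
    refine Finset.sum_congr rfl fun j _ => ?_
    simp [hP, mul_assoc]
  have h2 : A * (P * P.transpose) = 1 := by
    rw [← Matrix.mul_assoc]; exact mul_eq_one_comm.1 h1
  rw [Matrix.inv_eq_right_inv h2, Matrix.mul_apply]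
  simp [hP]

lemma differentiableAt_det {ι : Type*} [Fintype ι] [DecidableEq ι] {A : E m → Matrix ι ι ℝ}
    {y : E m} (hA : ∀ i j, DifferentiableAt ℝ (fun z => A z i j) y) :
    DifferentiableAt ℝ (fun z => (A z).det) y := by
  simp only [Matrix.det_apply']
  refine DifferentiableAt.fun_sum fun σ _ => ?_
  refine (differentiableAt_const _).mul ?_
  exact (HasFDerivAt.finsetProd (u := Finset.univ) (g := fun i z => A z (σ i) i)
    fun i _ => (hA _ _).hasFDerivAt).differentiableAt

lemma differentiableAt_matrix_inv {ι : Type*} [Fintype ι] [DecidableEq ι] {A : E m → Matrix ι ι ℝ}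
    {y : E m} (hA : ∀ i j, DifferentiableAt ℝ (fun z => A z i j) y) (h0 : (A y).det ≠ 0) (i j : ι) :
    DifferentiableAt ℝ (fun z => (A z)⁻¹ i j) y := by
  simp only [Matrix.inv_def, Ring.inverse_eq_inv', Matrix.smul_apply, smul_eq_mul,
    Matrix.adjugate_apply]
  refine ((differentiableAt_det hA).inv h0).mul (differentiableAt_det fun k l => ?_)
  simp only [Matrix.updateRow_apply]
  split_ifs
  · exact differentiableAt_const _
  · exact hA k l

end Coordinates

/-! ### Christoffel symbols and the Gauss equation -/

section Gauss

variable {m n : ℕ} {M : Type*} [TopologicalSpace M] [ChartedSpace (E m) M] [IsManifold (𝓡 m) ∞ M]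
  {g : RMetric m M} {φ : M → E n}

lemma IsIsometricImmersionEuclidean.chartInner_eq (hφ : IsIsometricImmersionEuclidean g φ) {p : M}
    {y : E m} (hy : y ∈ (extChartAt (𝓡 m) p).target) (a b : E m) :
    chartInner g p y a b = inner ℝ (fderiv ℝ (φ ∘ (extChartAt (𝓡 m) p).symm) y a)
      (fderiv ℝ (φ ∘ (extChartAt (𝓡 m) p).symm) y b) := by
  have hd := (hφ.smooth.mdifferentiable (by simp)) ((extChartAt (𝓡 m) p).symm y)
  rw [fderiv_comp_symm hd hy, fderiv_comp_symm hd hy, hφ.isometric]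
  rfl

lemma IsIsometricImmersionEuclidean.inner_eq (hφ : IsIsometricImmersionEuclidean g φ) {p : M}
    (v w : TangentSpace (𝓡 m) p) :
    g.inner p v w = inner ℝ (fderiv ℝ (φ ∘ (extChartAt (𝓡 m) p).symm) (base p) v)
      (fderiv ℝ (φ ∘ (extChartAt (𝓡 m) p).symm) (base p) w) := by
  have hd := (hφ.smooth.mdifferentiable (by simp)) p
  rw [← mvfderiv_eq_fderiv_base hd, ← mvfderiv_eq_fderiv_base hd, hφ.isometric]

lemma IsIsometricImmersionEuclidean.fderiv_injective (hφ : IsIsometricImmersionEuclidean g φ)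
    {p : M} {y : E m} (hy : y ∈ (extChartAt (𝓡 m) p).target) {a : E m}
    (ha : fderiv ℝ (φ ∘ (extChartAt (𝓡 m) p).symm) y a = 0) : a = 0 := by
  have h := hφ.chartInner_eq hy a a
  rw [ha, inner_zero_left] at h
  have h0 : fromChart p y a = 0 := by
    by_contra hne
    exact (g.pos _ _ hne).ne' h
  rw [← toChart_fromChart hy a, h0]
  exact map_zero _

lemma IsIsometricImmersionEuclidean.contDiffAt (hφ : IsIsometricImmersionEuclidean g φ) {p : M}
    {y : E m} (hy : y ∈ (extChartAt (𝓡 m) p).target) :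
    ContDiffAt ℝ ∞ (φ ∘ (extChartAt (𝓡 m) p).symm) y := contDiffAt_comp_symm hφ.smooth hy

lemma IsIsometricImmersionEuclidean.gram_eq (hφ : IsIsometricImmersionEuclidean g φ) {p : M}
    {y : E m} (hy : y ∈ (extChartAt (𝓡 m) p).target) (i j : Fin m) :
    gram g p y i j = inner ℝ (fderiv ℝ (φ ∘ (extChartAt (𝓡 m) p).symm) y (stdVec i))
      (fderiv ℝ (φ ∘ (extChartAt (𝓡 m) p).symm) y (stdVec j)) := hφ.chartInner_eq hy _ _

lemma IsIsometricImmersionEuclidean.gram_det_ne_zero (hφ : IsIsometricImmersionEuclidean g φ)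
    {p : M} {y : E m} (hy : y ∈ (extChartAt (𝓡 m) p).target) : (gram g p y).det ≠ 0 := by
  intro h0
  obtain ⟨v, hv, hv0⟩ := Matrix.exists_mulVec_eq_zero_iff.2 h0
  set a : E m := WithLp.toLp 2 v with ha
  set G := φ ∘ (extChartAt (𝓡 m) p).symm with hG
  have h1 : ∀ i, inner ℝ (fderiv ℝ G y (stdVec i)) (fderiv ℝ G y a) = (0 : ℝ) := by
    intro i
    rw [clm_apply_eq_sum _ a, inner_sum]
    have := congrFun hv0 i
    rw [Matrix.mulVec, dotProduct] at this
    refine Eq.trans ?_ this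
    refine Finset.sum_congr rfl fun j _ => ?_
    rw [inner_smul_right, hφ.gram_eq hy]
    simp [ha, mul_comm, hG]
  have h2 : inner ℝ (fderiv ℝ G y a) (fderiv ℝ G y a) = (0 : ℝ) := by
    conv_lhs => rw [clm_apply_eq_sum _ a, sum_inner]
    refine Finset.sum_eq_zero fun i _ => ?_
    rw [inner_smul_left, ← clm_apply_eq_sum, h1, mul_zero]
  have h3 := hφ.fderiv_injective hy (inner_self_eq_zero.1 h2)
  apply hv
  have := congrArg (fun b : E m => (b : Fin m → ℝ)) h3
  simpa [ha] using this

lemma IsIsometricImmersionEuclidean.pd_gram (hφ : IsIsometricImmersionEuclidean g φ) {p : M}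
    {y : E m} (hy : y ∈ (extChartAt (𝓡 m) p).target) {G : E m → E n}
    (hG : G = φ ∘ (extChartAt (𝓡 m) p).symm) (l i j : Fin m) :
    DifferentiableAt ℝ (fun z => gram g p z i j) y ∧
    pd l (fun z => gram g p z i j) y
      = inner ℝ (D2 G y (stdVec l) (stdVec i)) (fderiv ℝ G y (stdVec j))
        + inner ℝ (fderiv ℝ G y (stdVec i)) (D2 G y (stdVec l) (stdVec j)) := by
  have hGs : ContDiffAt ℝ ∞ G y := hG ▸ hφ.contDiffAt hy
  have h : (fun z => gram g p z i j)
      =ᶠ[𝓝 y] fun z => inner ℝ (fderiv ℝ G z (stdVec i)) (fderiv ℝ G z (stdVec j)) := by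
    filter_upwards [chart_target_mem_nhds hy] with z hz
    rw [hG]; exact hφ.gram_eq hz i j
  have hd : DifferentiableAt ℝ (fun z => fderiv ℝ G z (stdVec i)) y :=
    (contDiffAt_fderiv_apply hGs contDiffAt_const).differentiableAt (by simp)
  refine ⟨h.differentiableAt_iff.2 (differentiableAt_inner_fderiv hGs hd _), ?_⟩
  rw [pd, h.fderiv_eq, fderiv_inner_fderiv hGs hd, fderiv_fderiv_apply hGs]

lemma IsIsometricImmersionEuclidean.christoffel_eq (hφ : IsIsometricImmersionEuclidean g φ) {p : M}
    {y : E m} (hy : y ∈ (extChartAt (𝓡 m) p).target) {G : E m → E n}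
    (hG : G = φ ∘ (extChartAt (𝓡 m) p).symm) (k i j : Fin m) :
    christoffel g p k i j y = ∑ l, (gram g p y)⁻¹ k l
      * inner ℝ (D2 G y (stdVec i) (stdVec j)) (fderiv ℝ G y (stdVec l)) := by
  have hGs : ContDiffAt ℝ ∞ G y := hG ▸ hφ.contDiffAt hy
  rw [christoffel, Finset.mul_sum]
  refine Finset.sum_congr rfl fun l _ => ?_
  rw [(hφ.pd_gram hy hG _ _ _).2, (hφ.pd_gram hy hG _ _ _).2, (hφ.pd_gram hy hG _ _ _).2,
    D2_comm hGs (stdVec j) (stdVec i), D2_comm hGs (stdVec l) (stdVec i),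
    D2_comm hGs (stdVec l) (stdVec j),
    real_inner_comm (D2 G y (stdVec i) (stdVec l)) (fderiv ℝ G y (stdVec j))]
  ring

/-- `∑_k g_qk Γ^k_ij = ⟨∂_i ∂_j G, ∂_q G⟩` for an isometric immersion `G` in coordinates. -/
lemma IsIsometricImmersionEuclidean.sum_gram_christoffel (hφ : IsIsometricImmersionEuclidean g φ)
    {p : M} {y : E m} (hy : y ∈ (extChartAt (𝓡 m) p).target) {G : E m → E n}
    (hG : G = φ ∘ (extChartAt (𝓡 m) p).symm) (q i j : Fin m) :
    ∑ k, gram g p y q k * christoffel g p k i j y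
      = inner ℝ (D2 G y (stdVec i) (stdVec j)) (fderiv ℝ G y (stdVec q)) := by
  have hinv : gram g p y * (gram g p y)⁻¹ = 1 :=
    Matrix.mul_nonsing_inv _ (isUnit_iff_ne_zero.2 (hφ.gram_det_ne_zero hy))
  set w : Fin m → ℝ := fun l => inner ℝ (D2 G y (stdVec i) (stdVec j)) (fderiv ℝ G y (stdVec l))
  have h : (fun k => christoffel g p k i j y) = Matrix.mulVec (gram g p y)⁻¹ w := by
    funext k; exact hφ.christoffel_eq hy hG k i j
  have h2 : Matrix.mulVec (gram g p y) (fun k => christoffel g p k i j y) = w := by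
    rw [h, Matrix.mulVec_mulVec, hinv, Matrix.one_mulVec]
  exact congrFun h2 q

lemma IsIsometricImmersionEuclidean.differentiableAt_christoffel
    (hφ : IsIsometricImmersionEuclidean g φ)
    {p : M} {y : E m} (hy : y ∈ (extChartAt (𝓡 m) p).target) (k i j : Fin m) :
    DifferentiableAt ℝ (christoffel g p k i j) y := by
  set G := φ ∘ (extChartAt (𝓡 m) p).symm with hG
  have hGs : ContDiffAt ℝ ∞ G y := hφ.contDiffAt hy
  have h : christoffel g p k i j =ᶠ[𝓝 y] fun z => ∑ l, (gram g p z)⁻¹ k l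
      * inner ℝ (D2 G z (stdVec i) (stdVec j)) (fderiv ℝ G z (stdVec l)) := by
    filter_upwards [chart_target_mem_nhds hy] with z hz using hφ.christoffel_eq hz hG k i j
  rw [h.differentiableAt_iff]
  refine DifferentiableAt.fun_sum fun l _ => ?_
  refine (differentiableAt_matrix_inv (fun i j => (hφ.pd_gram hy hG i i j).1)
    (hφ.gram_det_ne_zero hy) k l).mul (differentiableAt_inner_fderiv hGs ?_ _)
  have h2 : ContDiffAt ℝ ∞ (fun z => fderiv ℝ (fderiv ℝ G) z (stdVec i) (stdVec j)) y :=
    ((contDiffAt_fderiv (contDiffAt_fderiv hGs)).clm_apply contDiffAt_const).clm_apply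
      contDiffAt_const
  exact h2.differentiableAt (by simp)

lemma christoffelVec_apply (p : M) (y a b : E m) (L : E m →L[ℝ] E n) :
    L (christoffelVec g p y a b)
      = ∑ k, (∑ i, ∑ j, christoffel g p k i j y * a i * b j) • L (stdVec k) := by
  simp [christoffelVec, map_sum]

/-- `DG(Γ(a, b))` is the tangential part of `D²G(a, b)`. -/
lemma IsIsometricImmersionEuclidean.inner_christoffelVec
    (hφ : IsIsometricImmersionEuclidean g φ)
    {p : M} {y : E m} (hy : y ∈ (extChartAt (𝓡 m) p).target) {G : E m → E n}
    (hG : G = φ ∘ (extChartAt (𝓡 m) p).symm) (a b w : E m) :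
    (inner ℝ (fderiv ℝ G y (christoffelVec g p y a b)) (fderiv ℝ G y w) : ℝ)
      = inner ℝ (D2 G y a b) (fderiv ℝ G y w) := by
  have h0 : ∀ q, (inner ℝ (fderiv ℝ G y (christoffelVec g p y a b)) (fderiv ℝ G y (stdVec q)) : ℝ)
      = inner ℝ (D2 G y a b) (fderiv ℝ G y (stdVec q)) := by
    intro q
    rw [christoffelVec_apply, D2_eq_sum, sum_inner, sum_inner]
    simp only [sum_inner, inner_smul_left, conj_trivial, ← hφ.sum_gram_christoffel hy hG]
    simp only [Finset.sum_mul, Finset.mul_sum]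
    rw [Finset.sum_comm]
    refine Finset.sum_congr rfl fun i _ => ?_
    rw [Finset.sum_comm]
    refine Finset.sum_congr rfl fun j _ => ?_
    refine Finset.sum_congr rfl fun k _ => ?_
    rw [hφ.gram_eq hy, ← hG, real_inner_comm]
    ring
  rw [clm_apply_eq_sum _ w, inner_sum, inner_sum]
  simp only [inner_smul_right, h0]

/-- The Gauss equation in a chart: `R_qkij = ⟨B_jk, B_iq⟩ - ⟨B_ik, B_jq⟩`, where
`B = D²G - DG(Γ)` is the second fundamental form. -/
lemma IsIsometricImmersionEuclidean.gauss
    (hφ : IsIsometricImmersionEuclidean g φ)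
    {p : M} {y : E m} (hy : y ∈ (extChartAt (𝓡 m) p).target) {G : E m → E n}
    (hG : G = φ ∘ (extChartAt (𝓡 m) p).symm) (q k i j : Fin m) :
    ∑ l, gram g p y q l * riemann g p l k i j y
      = inner ℝ (D2 G y (stdVec j) (stdVec k)
          - fderiv ℝ G y (christoffelVec g p y (stdVec j) (stdVec k))) (D2 G y (stdVec i) (stdVec q))
        - inner ℝ (D2 G y (stdVec i) (stdVec k)
          - fderiv ℝ G y (christoffelVec g p y (stdVec i) (stdVec k)))
          (D2 G y (stdVec j) (stdVec q)) := by
  have hGs : ContDiffAt ℝ ∞ G y := hG ▸ hφ.contDiffAt hy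
  have hGn : ∀ᶠ z in 𝓝 y, ContDiffAt ℝ ∞ G z := by
    filter_upwards [chart_target_mem_nhds hy] with z hz
    exact hG ▸ hφ.contDiffAt hz
  have hvec : ∀ a b, fderiv ℝ G y (christoffelVec g p y (stdVec a) (stdVec b))
      = ∑ l, christoffel g p l a b y • fderiv ℝ G y (stdVec l) := by
    intro a b
    rw [christoffelVec_apply]
    refine Finset.sum_congr rfl fun l _ => ?_
    congr 1
    simp [stdVec]
  have hD3 : ∀ b c, DifferentiableAt ℝ (fun z => D2 G z (stdVec b) (stdVec c)) y := by
    intro b c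
    have h2 : ContDiffAt ℝ ∞ (fun z => fderiv ℝ (fderiv ℝ G) z (stdVec b) (stdVec c)) y :=
      ((contDiffAt_fderiv (contDiffAt_fderiv hGs)).clm_apply contDiffAt_const).clm_apply
        contDiffAt_const
    exact h2.differentiableAt (by simp)
  -- third derivatives are symmetric
  have hT : ∀ a b c, fderiv ℝ (fun z => D2 G z (stdVec b) (stdVec c)) y (stdVec a)
      = fderiv ℝ (fun z => D2 G z (stdVec a) (stdVec c)) y (stdVec b) := by
    intro a b c
    have hh : ∀ b, (fun z => D2 G z (stdVec b) (stdVec c))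
        =ᶠ[𝓝 y] fun z => fderiv ℝ (fun w => fderiv ℝ G w (stdVec c)) z (stdVec b) := by
      intro b
      filter_upwards [hGn] with z hz
      rw [fderiv_fderiv_apply hz]
    have hs : ContDiffAt ℝ ∞ (fun w => fderiv ℝ G w (stdVec c)) y :=
      contDiffAt_fderiv_apply hGs contDiffAt_const
    rw [(hh b).fderiv_eq, (hh a).fderiv_eq, fderiv_fderiv_apply hs, fderiv_fderiv_apply hs,
      D2_comm hs]
  -- differentiate `∑ l, g_ql Γ^l_bc = ⟨∂_b ∂_c G, ∂_q G⟩`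
  have key : ∀ a b c, ∑ l, gram g p y q l * pd a (christoffel g p l b c) y
      = inner ℝ (fderiv ℝ (fun z => D2 G z (stdVec b) (stdVec c)) y (stdVec a))
          (fderiv ℝ G y (stdVec q))
        + inner ℝ (D2 G y (stdVec b) (stdVec c)
          - fderiv ℝ G y (christoffelVec g p y (stdVec b) (stdVec c))) (D2 G y (stdVec a) (stdVec q))
        - ∑ l, inner ℝ (D2 G y (stdVec a) (stdVec l)) (fderiv ℝ G y (stdVec q))
          * christoffel g p l b c y := by
    intro a b c
    have h1 : (fun z => ∑ l, gram g p z q l * christoffel g p l b c z)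
        =ᶠ[𝓝 y] fun z => inner ℝ (D2 G z (stdVec b) (stdVec c)) (fderiv ℝ G z (stdVec q)) := by
      filter_upwards [chart_target_mem_nhds hy] with z hz using
        hφ.sum_gram_christoffel hz hG q b c
    have h2 := congrArg (fun L => L (stdVec a)) (h1.fderiv_eq (𝕜 := ℝ))
    have h3 : HasFDerivAt (fun z => ∑ l, gram g p z q l * christoffel g p l b c z)
        (∑ l, (gram g p y q l • fderiv ℝ (christoffel g p l b c) y
          + christoffel g p l b c y • fderiv ℝ (fun z => gram g p z q l) y)) y :=
      HasFDerivAt.fun_sum fun l _ => HasFDerivAt.fun_mul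
        ((hφ.pd_gram hy hG a q l).1).hasFDerivAt
        (hφ.differentiableAt_christoffel hy l b c).hasFDerivAt
    have h4 : ∀ l, fderiv ℝ (fun z => gram g p z q l) y (stdVec a)
        = inner ℝ (D2 G y (stdVec a) (stdVec q)) (fderiv ℝ G y (stdVec l))
        + inner ℝ (fderiv ℝ G y (stdVec q)) (D2 G y (stdVec a) (stdVec l)) :=
      fun l => (hφ.pd_gram hy hG a q l).2
    simp only [h3.fderiv, fderiv_inner_fderiv hGs (hD3 b c), sum_apply, add_apply, smul_apply,
      smul_eq_mul, h4, Finset.sum_add_distrib] at h2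
    rw [inner_sub_left, hvec, sum_inner]
    simp only [pd, inner_smul_left, conj_trivial]
    have h5 : ∑ l, christoffel g p l b c y
          * (inner ℝ (D2 G y (stdVec a) (stdVec q)) (fderiv ℝ G y (stdVec l))
            + inner ℝ (fderiv ℝ G y (stdVec q)) (D2 G y (stdVec a) (stdVec l)))
        = ∑ l, christoffel g p l b c y
            * inner ℝ (fderiv ℝ G y (stdVec l)) (D2 G y (stdVec a) (stdVec q))
          + ∑ l, inner ℝ (D2 G y (stdVec a) (stdVec l)) (fderiv ℝ G y (stdVec q))
            * christoffel g p l b c y := by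
      rw [← Finset.sum_add_distrib]
      refine Finset.sum_congr rfl fun l _ => ?_
      rw [real_inner_comm (D2 G y (stdVec a) (stdVec q)) (fderiv ℝ G y (stdVec l)),
        real_inner_comm (fderiv ℝ G y (stdVec q)) (D2 G y (stdVec a) (stdVec l))]
      ring
    linear_combination h2 - h5
  have quad : ∀ a b, ∑ l, gram g p y q l * ∑ s, christoffel g p l a s y * christoffel g p s b k y
      = ∑ s, inner ℝ (D2 G y (stdVec a) (stdVec s)) (fderiv ℝ G y (stdVec q))
        * christoffel g p s b k y := by
    intro a b
    simp only [Finset.mul_sum]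
    rw [Finset.sum_comm]
    refine Finset.sum_congr rfl fun s _ => ?_
    rw [← hφ.sum_gram_christoffel hy hG, Finset.sum_mul]
    refine Finset.sum_congr rfl fun l _ => by ring
  simp only [riemann, mul_add, mul_sub, Finset.sum_add_distrib, Finset.sum_sub_distrib]
  rw [key, key, quad, quad, hT i j k]
  ring

end Gauss

/-! ### Ricci curvature, Laplacian and connection in an orthonormal frame -/

section Frames

variable {m n : ℕ}

lemma linearMap_apply_eq_sum {W : Type*} [AddCommGroup W] [Module ℝ W] (L : E m →ₗ[ℝ] W)
    (a : E m) : L a = ∑ i, a i • L (stdVec i) := by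
  conv_lhs => rw [← sum_smul_stdVec a]
  simp [map_sum]

/-- The normal part of the second derivative, as a bilinear map. -/
noncomputable def normalHess {ι : Type*} [Fintype ι] (u : ι → E n) (G : E m → E n) (y : E m) :
    E m →ₗ[ℝ] E m →ₗ[ℝ] E n :=
  LinearMap.mk₂ ℝ (fun a b => normalPart u (D2 G y a b))
    (fun a a' b => by rw [D2_add_left, normalPart_add])
    (fun r a b => by rw [D2_smul_left, normalPart_smul])
    (fun a b b' => by rw [D2_add_right, normalPart_add])
    (fun r a b => by rw [D2_smul_right, normalPart_smul])

lemma normalHess_apply {ι : Type*} [Fintype ι] (u : ι → E n) (G : E m → E n) (y a b : E m) :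
    normalHess u G y a b = normalPart u (D2 G y a b) := rfl

/-- The right-hand side `⟨B(v, w), B(a, b)⟩ - ⟨B(a, w), B(v, b)⟩` of the Gauss equation. -/
noncomputable def gaussForm (B : E m →ₗ[ℝ] E m →ₗ[ℝ] E n) (v w a b : E m) : ℝ :=
  inner ℝ (B v w) (B a b) - inner ℝ (B a w) (B v b)

lemma gaussForm_eq_sum (B : E m →ₗ[ℝ] E m →ₗ[ℝ] E n) (v w a b : E m) :
    gaussForm B v w a b = ∑ j, ∑ k, ∑ i, ∑ q,
      (v j * w k * (a i * b q)) * gaussForm B (stdVec j) (stdVec k) (stdVec i) (stdVec q) := by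
  have h1 : ∀ v w a b, gaussForm B v w a b = ∑ j, v j * gaussForm B (stdVec j) w a b := by
    intro v w a b
    simp only [gaussForm, mul_sub, Finset.sum_sub_distrib]
    rw [linearMap_apply_eq_sum B v]
    simp [sum_inner, inner_sum, inner_smul_left, inner_smul_right]
  have h2 : ∀ v w a b, gaussForm B v w a b = ∑ k, w k * gaussForm B v (stdVec k) a b := by
    intro v w a b
    simp only [gaussForm, mul_sub, Finset.sum_sub_distrib]
    rw [linearMap_apply_eq_sum (B v) w, linearMap_apply_eq_sum (B a) w]
    simp [sum_inner, inner_smul_left]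
  have h3 : ∀ v w a b, gaussForm B v w a b = ∑ i, a i * gaussForm B v w (stdVec i) b := by
    intro v w a b
    simp only [gaussForm, mul_sub, Finset.sum_sub_distrib]
    rw [linearMap_apply_eq_sum B a]
    simp [sum_inner, inner_sum, inner_smul_left, inner_smul_right]
  have h4 : ∀ v w a b, gaussForm B v w a b = ∑ q, b q * gaussForm B v w a (stdVec q) := by
    intro v w a b
    simp only [gaussForm, mul_sub, Finset.sum_sub_distrib]
    rw [linearMap_apply_eq_sum (B v) b, linearMap_apply_eq_sum (B a) b]
    simp [inner_sum, inner_smul_right]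
  rw [h1]
  refine Finset.sum_congr rfl fun j _ => ?_
  rw [h2, Finset.mul_sum]
  refine Finset.sum_congr rfl fun k _ => ?_
  rw [h3, Finset.mul_sum, Finset.mul_sum]
  refine Finset.sum_congr rfl fun i _ => ?_
  rw [h4, Finset.mul_sum, Finset.mul_sum, Finset.mul_sum]
  refine Finset.sum_congr rfl fun q _ => ?_
  ring

end Frames

section Curvature

variable {m n : ℕ} {M : Type*} [TopologicalSpace M] [ChartedSpace (E m) M] [IsManifold (𝓡 m) ∞ M]
  {g : RMetric m M} {φ : M → E n}

lemma IsIsometricImmersionEuclidean.gram_inv (hφ : IsIsometricImmersionEuclidean g φ) {p : M}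
    {y : E m} (hy : y ∈ (extChartAt (𝓡 m) p).target) {G : E m → E n}
    (hG : G = φ ∘ (extChartAt (𝓡 m) p).symm) {f : Fin m → E m}
    (hf : ∀ a b, inner ℝ (fderiv ℝ G y (f a)) (fderiv ℝ G y (f b)) = if a = b then (1 : ℝ) else 0)
    (i j : Fin m) : (gram g p y)⁻¹ i j = ∑ a, f a i * f a j := by
  refine gram_inv_eq_sum (fun a b => ?_) i j
  rw [← hf a b, clm_apply_eq_sum _ (f a), clm_apply_eq_sum _ (f b)]
  simp only [sum_inner, inner_sum, inner_smul_left, inner_smul_right, hφ.gram_eq hy, ← hG,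
    conj_trivial]
  rw [Finset.sum_comm]
  refine Finset.sum_congr rfl fun i _ => ?_
  rw [Finset.mul_sum]
  refine Finset.sum_congr rfl fun j _ => ?_
  ring

/-- The Ricci tensor of an immersed manifold in an orthonormal frame, by the Gauss equation. -/
theorem IsIsometricImmersionEuclidean.ricci_eq (hφ : IsIsometricImmersionEuclidean g φ) {p : M}
    {G : E m → E n} (hG : G = φ ∘ (extChartAt (𝓡 m) p).symm) {f : Fin m → E m}
    (hf : ∀ a b, inner ℝ (fderiv ℝ G (base p) (f a)) (fderiv ℝ G (base p) (f b))
      = if a = b then (1 : ℝ) else 0) (v w : E m) :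
    ricci g p v w = ∑ a, gaussForm
      (normalHess (fun a => fderiv ℝ G (base p) (f a)) G (base p)) v w (f a) (f a) := by
  have hy := base_mem_target (m := m) p
  have hGs : ContDiffAt ℝ ∞ G (base p) := hG ▸ hφ.contDiffAt hy
  set B := normalHess (fun a => fderiv ℝ G (base p) (f a)) G (base p) with hB
  have hnB : ∀ a b, D2 G (base p) a b - fderiv ℝ G (base p) (christoffelVec g p (base p) a b)
      = B a b := fun a b =>
    normalPart_eq_of_inner_eq hf fun c => hφ.inner_christoffelVec hy hG a b c
  have hBB : ∀ a b c d, (inner ℝ (B a b) (D2 G (base p) c d) : ℝ) = inner ℝ (B a b) (B c d) := by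
    intro a b c d
    rw [← hnB c d, inner_sub_right, hB, normalHess_apply, inner_normalPart_map hf, sub_zero]
  have hR : ∀ q k i j, ∑ l, gram g p (base p) q l * riemann g p l k i j (base p)
      = gaussForm B (stdVec j) (stdVec k) (stdVec i) (stdVec q) := by
    intro q k i j
    rw [hφ.gauss hy hG, hnB, hnB, hBB, hBB]
    rfl
  have hinv : (gram g p (base p))⁻¹ * gram g p (base p) = 1 :=
    Matrix.nonsing_inv_mul _ (isUnit_iff_ne_zero.2 (hφ.gram_det_ne_zero hy))
  have hR' : ∀ r k i j, riemann g p r k i j (base p) = ∑ q, (gram g p (base p))⁻¹ r q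
      * gaussForm B (stdVec j) (stdVec k) (stdVec i) (stdVec q) := by
    intro r k i j
    simp only [← hR]
    have h1 : Matrix.mulVec (gram g p (base p))⁻¹ (Matrix.mulVec (gram g p (base p))
        (fun l => riemann g p l k i j (base p))) = fun l => riemann g p l k i j (base p) := by
      rw [Matrix.mulVec_mulVec, hinv, Matrix.one_mulVec]
    exact (congrFun h1 r).symm
  have hv : ∀ u : E m, toChart p p u = u := toChart_self p
  simp only [ricci, ricciCoord, hR', hφ.gram_inv hy hG hf, hv]
  simp only [gaussForm_eq_sum B v w]
  rw [Finset.sum_comm (s := Finset.univ) (t := Finset.univ)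
    (f := fun a j => ∑ k, ∑ i, ∑ q, (v j * w k * (f a i * f a q))
      * gaussForm B (stdVec j) (stdVec k) (stdVec i) (stdVec q))]
  refine Finset.sum_congr rfl fun j _ => ?_
  rw [Finset.sum_comm (s := Finset.univ) (t := Finset.univ)
    (f := fun a k => ∑ i, ∑ q, (v j * w k * (f a i * f a q))
      * gaussForm B (stdVec j) (stdVec k) (stdVec i) (stdVec q))]
  refine Finset.sum_congr rfl fun k _ => ?_
  rw [Finset.sum_mul, Finset.sum_mul, Finset.sum_comm (s := Finset.univ) (t := Finset.univ)
    (f := fun a i => ∑ q, (v j * w k * (f a i * f a q))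
      * gaussForm B (stdVec j) (stdVec k) (stdVec i) (stdVec q))]
  refine Finset.sum_congr rfl fun i _ => ?_
  rw [Finset.sum_mul, Finset.sum_mul, Finset.sum_comm (s := Finset.univ) (t := Finset.univ)
    (f := fun a q => (v j * w k * (f a i * f a q))
      * gaussForm B (stdVec j) (stdVec k) (stdVec i) (stdVec q))]
  refine Finset.sum_congr rfl fun q _ => ?_
  rw [Finset.sum_mul, Finset.sum_mul, Finset.sum_mul]
  refine Finset.sum_congr rfl fun a _ => ?_
  ring

/-- The normalized scalar curvature as the trace of the Ricci tensor in an orthonormal frame. -/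
theorem IsIsometricImmersionEuclidean.normScal_eq (hφ : IsIsometricImmersionEuclidean g φ) {p : M}
    {G : E m → E n} (hG : G = φ ∘ (extChartAt (𝓡 m) p).symm) {f : Fin m → E m}
    (hf : ∀ a b, inner ℝ (fderiv ℝ G (base p) (f a)) (fderiv ℝ G (base p) (f b))
      = if a = b then (1 : ℝ) else 0) :
    normScal g p = (∑ b, ricci g p (f b) (f b)) / ((m : ℝ) * ((m : ℝ) - 1)) := by
  have hv : ∀ u : E m, toChart p p u = u := toChart_self p
  rw [normScal]
  congr 1
  simp only [ricci, hφ.gram_inv (base_mem_target (m := m) p) hG hf]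
  rw [Finset.sum_comm (s := Finset.univ) (t := Finset.univ)
    (f := fun b j => ∑ k, ricciCoord g p j k (base p) * toChart p p (f b) j * toChart p p (f b) k)]
  refine Finset.sum_congr rfl fun j _ => ?_
  rw [Finset.sum_comm (s := Finset.univ) (t := Finset.univ)
    (f := fun b k => ricciCoord g p j k (base p) * toChart p p (f b) j * toChart p p (f b) k)]
  refine Finset.sum_congr rfl fun k _ => ?_
  rw [Finset.sum_mul]
  refine Finset.sum_congr rfl fun b _ => ?_
  rw [hv (f b)]
  ring

/-- The Laplacian as the trace of the Hessian in an orthonormal frame `f`, the vectors `f a` being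
extended with constant components. -/
theorem IsIsometricImmersionEuclidean.laplacian_eq (hφ : IsIsometricImmersionEuclidean g φ) {p : M}
    {G : E m → E n} (hG : G = φ ∘ (extChartAt (𝓡 m) p).symm) {f : Fin m → E m}
    (hf : ∀ a b, inner ℝ (fderiv ℝ G (base p) (f a)) (fderiv ℝ G (base p) (f b))
      = if a = b then (1 : ℝ) else 0) {u : M → ℝ}
    (hu : ContDiffAt ℝ ∞ (u ∘ (extChartAt (𝓡 m) p).symm) (base p)) :
    laplacian g u p = ∑ a, (D2 (u ∘ (extChartAt (𝓡 m) p).symm) (base p) (f a) (f a)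
      - fderiv ℝ (u ∘ (extChartAt (𝓡 m) p).symm) (base p)
          (christoffelVec g p (base p) (f a) (f a))) := by
  set U := u ∘ (extChartAt (𝓡 m) p).symm with hU
  have h1 : ∀ a, D2 U (base p) (f a) (f a)
      - fderiv ℝ U (base p) (christoffelVec g p (base p) (f a) (f a))
      = ∑ i, ∑ j, (f a i * f a j) * (D2 U (base p) (stdVec i) (stdVec j)
        - ∑ k, christoffel g p k i j (base p) * fderiv ℝ U (base p) (stdVec k)) := by
    intro a
    rw [D2_eq_sum]
    simp only [christoffelVec, map_sum, map_smul, smul_eq_mul, mul_sub, Finset.sum_sub_distrib]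
    congr 1
    simp only [Finset.sum_mul, Finset.mul_sum]
    rw [Finset.sum_comm]
    refine Finset.sum_congr rfl fun i _ => ?_
    rw [Finset.sum_comm]
    refine Finset.sum_congr rfl fun j _ => ?_
    refine Finset.sum_congr rfl fun k _ => ?_
    ring
  simp only [h1]
  have h2 : ∀ i j, pd i (pd j U) (base p) = D2 U (base p) (stdVec i) (stdVec j) := fun i j =>
    fderiv_fderiv_apply hu _ _
  simp only [laplacian, hφ.gram_inv (base_mem_target (m := m) p) hG hf, ← hU, h2]
  rw [Finset.sum_comm (s := Finset.univ) (t := Finset.univ)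
    (f := fun a i => ∑ j, (f a i * f a j) * (D2 U (base p) (stdVec i) (stdVec j)
        - ∑ k, christoffel g p k i j (base p) * fderiv ℝ U (base p) (stdVec k)))]
  refine Finset.sum_congr rfl fun i _ => ?_
  rw [Finset.sum_comm (s := Finset.univ) (t := Finset.univ)
    (f := fun a j => (f a i * f a j) * (D2 U (base p) (stdVec i) (stdVec j)
        - ∑ k, christoffel g p k i j (base p) * fderiv ℝ U (base p) (stdVec k)))]
  refine Finset.sum_congr rfl fun j _ => ?_
  rw [Finset.sum_mul]
  rfl

/-- The Levi-Civita connection is the tangential part of the flat one: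
`⟨∇_v X, w⟩ = ⟨D_v (dφ X), dφ w⟩`. Unlike its definition, the right-hand side does not refer to
Christoffel symbols, so it can be compared between charts. -/
theorem IsIsometricImmersionEuclidean.innerCovDeriv_eq (hφ : IsIsometricImmersionEuclidean g φ)
    {p : M} {G : E m → E n} (hG : G = φ ∘ (extChartAt (𝓡 m) p).symm)
    {X : (q : M) → TangentSpace (𝓡 m) q} (hX : ContDiffAt ℝ ∞ (chartField p X) (base p))
    (v w : E m) :
    innerCovDeriv g X p v w
      = inner ℝ (fderiv ℝ (fun z => fderiv ℝ G z (chartField p X z)) (base p) v)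
          (fderiv ℝ G (base p) w) := by
  have hy := base_mem_target (m := m) p
  have hGs : ContDiffAt ℝ ∞ G (base p) := hG ▸ hφ.contDiffAt hy
  have hv : ∀ u : E m, toChart p p u = u := toChart_self p
  change chartInner g p (base p)
    (fderiv ℝ (chartField p X) (base p) (toChart p p v)
      + christoffelVec g p (base p) (toChart p p v) (chartField p X (base p))) (toChart p p w) = _
  rw [hφ.chartInner_eq hy, ← hG, hv, hv, map_add, inner_add_left,
    hφ.inner_christoffelVec hy hG, ← inner_add_left, fderiv_fderiv_field hGs hX, add_comm]

lemma IsIsometricImmersionEuclidean.fderiv_chartField (hφ : IsIsometricImmersionEuclidean g φ)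
    (p : M) {z : E m} (hz : z ∈ (extChartAt (𝓡 m) p).target) (X : (q : M) → TangentSpace (𝓡 m) q) :
    fderiv ℝ (φ ∘ (extChartAt (𝓡 m) p).symm) z (chartField p X z)
      = mvfderiv (𝓡 m) φ ((extChartAt (𝓡 m) p).symm z) (X ((extChartAt (𝓡 m) p).symm z)) := by
  rw [fderiv_comp_symm ((hφ.smooth.mdifferentiable (by simp)) _) hz, chartField,
    fromChart_toChart hz]

end Curvature

/-! ### Smooth fields read in charts -/

section Smoothness

variable {m : ℕ} {M : Type*} [TopologicalSpace M] [ChartedSpace (E m) M] [IsManifold (𝓡 m) ∞ M]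
  {W : Type*} [NormedAddCommGroup W] [NormedSpace ℝ W]

lemma contDiffAt_comp_symm_base {u : M → W} {p : M} (hu : ContMDiffAt (𝓡 m) 𝓘(ℝ, W) ∞ u p) :
    ContDiffAt ℝ ∞ (u ∘ (extChartAt (𝓡 m) p).symm) (base p) := by
  have h1 : ContMDiffAt 𝓘(ℝ, E m) (𝓡 m) ∞ (extChartAt (𝓡 m) p).symm (base p) :=
    (contMDiffOn_extChartAt_symm (I := 𝓡 m) (n := ∞) p).contMDiffAt
      (chart_target_mem_nhds (base_mem_target (m := m) p))
  have h2 : ContMDiffAt (𝓡 m) 𝓘(ℝ, W) ∞ u ((extChartAt (𝓡 m) p).symm (base p)) := by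
    rw [symm_base]; exact hu
  exact contMDiffAt_iff_contDiffAt.1 (ContMDiffAt.comp (base p) h2 h1)

lemma contDiffAt_chartField {X : (q : M) → TangentSpace (𝓡 m) q}
    (hX : ContMDiff (𝓡 m) (𝓡 m).tangent ∞ (fun q => (⟨q, X q⟩ : TangentBundle (𝓡 m) M))) (p : M) :
    ContDiffAt ℝ ∞ (chartField p X) (base p) := by
  have h1 := (Bundle.contMDiffAt_section (IB := 𝓡 m) (F := E m)
    (E := fun q : M => TangentSpace (𝓡 m) q) (s := X) (n := ∞) p).1 (hX p)
  refine (contDiffAt_comp_symm_base h1).congr_of_eventuallyEq ?_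
  filter_upwards [chart_target_mem_nhds (base_mem_target (m := m) p)] with z hz
  have hq : (extChartAt (𝓡 m) p).symm z ∈ (chartAt (E m) p).source := by
    have := (extChartAt (𝓡 m) p).map_target hz
    rwa [extChartAt_source] at this
  have hb : (extChartAt (𝓡 m) p).symm z
      ∈ (trivializationAt (E m) (TangentSpace (𝓡 m)) p).baseSet := by
    simpa using! hq
  have h2 := TangentBundle.continuousLinearMapAt_trivializationAt (𝕜 := ℝ) (I := 𝓡 m) hq
  have h3 := congrArg (fun L => L (X ((extChartAt (𝓡 m) p).symm z))) h2
  refine Eq.trans h3.symm ?_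
  simp only [Function.comp]
  rw [Bundle.Trivialization.continuousLinearMapAt_apply,
    Bundle.Trivialization.coe_linearMapAt_of_mem _ hb]

/-- A field of endomorphisms read in the chart at `p`. -/
noncomputable def chartEndo (p : M) (J : (q : M) → TangentSpace (𝓡 m) q →L[ℝ] TangentSpace (𝓡 m) q)
    (z : E m) : E m →L[ℝ] E m :=
  (mfderiv (𝓡 m) 𝓘(ℝ, E m) (extChartAt (𝓡 m) p) ((extChartAt (𝓡 m) p).symm z)).comp
    ((J ((extChartAt (𝓡 m) p).symm z)).comp
      (mfderiv 𝓘(ℝ, E m) (𝓡 m) (extChartAt (𝓡 m) p).symm z))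

omit [IsManifold (𝓡 m) ∞ M] in
lemma chartEndo_apply (p : M) (J : (q : M) → TangentSpace (𝓡 m) q →L[ℝ] TangentSpace (𝓡 m) q)
    (z a : E m) : chartEndo p J z a = toChart p ((extChartAt (𝓡 m) p).symm z)
      (J ((extChartAt (𝓡 m) p).symm z) (fromChart p z a)) := rfl

lemma contDiffAt_chartEndo {J : (q : M) → TangentSpace (𝓡 m) q →L[ℝ] TangentSpace (𝓡 m) q}
    (hJ : ContMDiff (𝓡 m) ((𝓡 m).prod 𝓘(ℝ, E m →L[ℝ] E m)) ∞
      (fun q => Bundle.TotalSpace.mk' (E m →L[ℝ] E m)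
        (E := fun q : M => TangentSpace (𝓡 m) q →L[ℝ] TangentSpace (𝓡 m) q) q (J q))) (p : M) :
    ContDiffAt ℝ ∞ (chartEndo p J) (base p) := by
  have h1 := (Bundle.contMDiffAt_section (IB := 𝓡 m) (F := E m →L[ℝ] E m)
    (E := fun q : M => TangentSpace (𝓡 m) q →L[ℝ] TangentSpace (𝓡 m) q) (s := J) (n := ∞) p).1 (hJ p)
  refine (contDiffAt_comp_symm_base h1).congr_of_eventuallyEq ?_
  filter_upwards [chart_target_mem_nhds (base_mem_target (m := m) p)] with z hz
  have hq : (extChartAt (𝓡 m) p).symm z ∈ (chartAt (E m) p).source := by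
    have := (extChartAt (𝓡 m) p).map_target hz
    rwa [extChartAt_source] at this
  have h2 := TangentBundle.continuousLinearMapAt_trivializationAt (𝕜 := ℝ) (I := 𝓡 m) hq
  have h3 := TangentBundle.symmL_trivializationAt (𝕜 := ℝ) (I := 𝓡 m) hq
  have hr : Set.range (𝓡 m) = Set.univ := by simp
  rw [hr, mfderivWithin_univ, (extChartAt (𝓡 m) p).right_inv hz] at h3
  have h4 : ∀ a, (trivializationAt (E m) (TangentSpace (𝓡 m)) p).symmL ℝ
      ((extChartAt (𝓡 m) p).symm z) a = fromChart p z a := fun a => congrArg (fun L => L a) h3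
  have h5 : ∀ v, (trivializationAt (E m) (TangentSpace (𝓡 m)) p).continuousLinearMapAt ℝ
      ((extChartAt (𝓡 m) p).symm z) v = toChart p ((extChartAt (𝓡 m) p).symm z) v :=
    fun v => congrArg (fun L => L v) h2
  ext1 a
  rw [chartEndo_apply, ← h4, ← h5]
  rfl

end Smoothness

/-! ### Harmonic fields as functions with values in Euclidean space -/

section Transfer

variable {n : ℕ} {S : Type*} [TopologicalSpace S] [ChartedSpace (E 2) S] [IsManifold (𝓡 2) ∞ S]
  {g : RMetric 2 S} {Φ : S → E n}

/-- A tangent field regarded as an `ℝⁿ`-valued function through the immersion `Φ`. -/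
noncomputable def ambientField (Φ : S → E n) (X : (q : S) → TangentSpace (𝓡 2) q) (q : S) : E n :=
  mvfderiv (𝓡 2) Φ q (X q)

lemma ambientField_comp_symm (hΦ : IsIsometricImmersionEuclidean g Φ)
    (p : S) (X : (q : S) → TangentSpace (𝓡 2) q) {z : E 2}
    (hz : z ∈ (extChartAt (𝓡 2) p).target) :
    (ambientField Φ X ∘ (extChartAt (𝓡 2) p).symm) z
      = fderiv ℝ (Φ ∘ (extChartAt (𝓡 2) p).symm) z (chartField p X z) :=
  (hΦ.fderiv_chartField p hz X).symm

lemma ambientField_comp_symm_eventuallyEq (hΦ : IsIsometricImmersionEuclidean g Φ)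
    (p : S) (X : (q : S) → TangentSpace (𝓡 2) q) {z : E 2}
    (hz : z ∈ (extChartAt (𝓡 2) p).target) :
    (ambientField Φ X ∘ (extChartAt (𝓡 2) p).symm)
      =ᶠ[𝓝 z] fun z => fderiv ℝ (Φ ∘ (extChartAt (𝓡 2) p).symm) z (chartField p X z) := by
  filter_upwards [chart_target_mem_nhds hz] with w hw using ambientField_comp_symm hΦ p X hw

lemma mdifferentiableAt_ambientField (hΦ : IsIsometricImmersionEuclidean g Φ)
    {p : S} {X : (q : S) → TangentSpace (𝓡 2) q} (hX : ContDiffAt ℝ ∞ (chartField p X) (base p)) :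
    MDifferentiableAt (𝓡 2) 𝓘(ℝ, E n) (ambientField Φ X) p := by
  have hy := base_mem_target (m := 2) p
  have h1 : ContDiffAt ℝ ∞ (ambientField Φ X ∘ (extChartAt (𝓡 2) p).symm) (base p) :=
    (contDiffAt_fderiv_apply (hΦ.contDiffAt hy) hX).congr_of_eventuallyEq
      (ambientField_comp_symm_eventuallyEq hΦ p X hy)
  have h2 : MDifferentiableAt (𝓡 2) 𝓘(ℝ, E 2) (extChartAt (𝓡 2) p) p :=
    mdifferentiableAt_extChartAt (mem_chart_source _ p)
  have h3 : ambientField Φ X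
      =ᶠ[𝓝 p] (ambientField Φ X ∘ (extChartAt (𝓡 2) p).symm) ∘ extChartAt (𝓡 2) p := by
    filter_upwards [extChartAt_source_mem_nhds (I := 𝓡 2) p] with q hq
    exact congrArg (ambientField Φ X) ((extChartAt (𝓡 2) p).left_inv hq).symm
  exact (MDifferentiableAt.comp (I' := 𝓘(ℝ, E 2)) (f := extChartAt (𝓡 2) p) p
    (h1.differentiableAt (by simp)).mdifferentiableAt h2).congr_of_eventuallyEq h3

lemma isCoordHarmonic_congr {F V V' : E 2 → E n} {z : E 2} (h : V =ᶠ[𝓝 z] V')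
    (hV : IsCoordHarmonic F V z) : IsCoordHarmonic F V' z := by
  refine ⟨fun a b => ?_, fun a b => ?_⟩
  · rw [← h.fderiv_eq]; exact hV.closed a b
  · rw [← h.fderiv_eq]; exact hV.coclosed a b

/-- The harmonicity equations hold at a point in the chart at `p` as soon as they hold in the chart
at that point. -/
lemma isCoordHarmonic_of_base (hΦ : IsIsometricImmersionEuclidean g Φ)
    {V : S → E n} {p : S} {z : E 2} (hz : z ∈ (extChartAt (𝓡 2) p).target)
    (hVd : MDifferentiableAt (𝓡 2) 𝓘(ℝ, E n) V ((extChartAt (𝓡 2) p).symm z))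
    (h : IsCoordHarmonic (Φ ∘ (extChartAt (𝓡 2) ((extChartAt (𝓡 2) p).symm z)).symm)
      (V ∘ (extChartAt (𝓡 2) ((extChartAt (𝓡 2) p).symm z)).symm)
      (base ((extChartAt (𝓡 2) p).symm z))) :
    IsCoordHarmonic (Φ ∘ (extChartAt (𝓡 2) p).symm) (V ∘ (extChartAt (𝓡 2) p).symm) z := by
  have hΦd : MDifferentiableAt (𝓡 2) 𝓘(ℝ, E n) Φ ((extChartAt (𝓡 2) p).symm z) :=
    hΦ.smooth.mdifferentiable (by simp) _
  have hF : ∀ a, fderiv ℝ (Φ ∘ (extChartAt (𝓡 2) p).symm) z a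
      = fderiv ℝ (Φ ∘ (extChartAt (𝓡 2) ((extChartAt (𝓡 2) p).symm z)).symm)
        (base ((extChartAt (𝓡 2) p).symm z)) (fromChart p z a) := fun a => by
    rw [fderiv_comp_symm hΦd hz, mvfderiv_eq_fderiv_base hΦd]
  have hV : ∀ a, fderiv ℝ (V ∘ (extChartAt (𝓡 2) p).symm) z a
      = fderiv ℝ (V ∘ (extChartAt (𝓡 2) ((extChartAt (𝓡 2) p).symm z)).symm)
        (base ((extChartAt (𝓡 2) p).symm z)) (fromChart p z a) := fun a => by
    rw [fderiv_comp_symm hVd hz, mvfderiv_eq_fderiv_base hVd]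
  refine ⟨fun a b => ?_, fun a b => ?_⟩
  · simp only [hF, hV]; exact h.closed _ _
  · simp only [hF, hV]; exact h.coclosed _ _

/-- An injective linear map is isometric for some inner product on its domain, so it admits an
orthonormal frame. -/
lemma exists_frame {m : ℕ} (L : E m →L[ℝ] E n) (hL : ∀ a, L a = 0 → a = 0) :
    ∃ f : Fin m → E m, ∀ a b, inner ℝ (L (f a)) (L (f b)) = if a = b then (1 : ℝ) else 0 := by
  have hinj : Function.Injective L.toLinearMap := (injective_iff_map_eq_zero _).2 hL
  have hr : Module.finrank ℝ (LinearMap.range L.toLinearMap) = m := by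
    rw [LinearMap.finrank_range_of_inj hinj]; simp
  let b := (stdOrthonormalBasis ℝ (LinearMap.range L.toLinearMap)).reindex (finCongr hr)
  have hb : ∀ i, ∃ v : E m, L v = b i := fun i => (b i).2
  choose f hf using hb
  refine ⟨f, fun i j => ?_⟩
  rw [hf, hf]
  exact orthonormal_iff_ite.1 b.orthonormal i j

/-- A symmetric form with vanishing trace in one orthonormal frame satisfies the frame-free form of
the trace condition. -/
lemma isCoordHarmonic_of_frame {F V : E 2 → E n} {z : E 2} {e : Fin 2 → E 2}
    (he : ∀ i j, inner ℝ (fderiv ℝ F z (e i)) (fderiv ℝ F z (e j)) = if i = j then (1 : ℝ) else 0)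
    (hsymm : ∀ a b, (inner ℝ (fderiv ℝ V z a) (fderiv ℝ F z b) : ℝ)
      = inner ℝ (fderiv ℝ V z b) (fderiv ℝ F z a))
    (htr : ∑ i, (inner ℝ (fderiv ℝ V z (e i)) (fderiv ℝ F z (e i)) : ℝ) = 0) :
    IsCoordHarmonic F V z := by
  refine ⟨hsymm, fun a b => ?_⟩
  obtain ⟨a₁, a₂, rfl⟩ := exists_coords_of_orthonormal (fderiv ℝ F z) e he a
  obtain ⟨b₁, b₂, rfl⟩ := exists_coords_of_orthonormal (fderiv ℝ F z) e he b
  rw [Fin.sum_univ_two] at htr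
  have h1 : (inner ℝ (fderiv ℝ V z (e 1)) (fderiv ℝ F z (e 1)) : ℝ)
      = - inner ℝ (fderiv ℝ V z (e 0)) (fderiv ℝ F z (e 0)) := by linarith
  simp only [map_add, map_smul, inner_add_left, inner_add_right, inner_smul_left,
    inner_smul_right, he, h1, hsymm (e 1) (e 0), conj_trivial]
  simp
  ring

lemma isCoordHarmonic_base (hΦ : IsIsometricImmersionEuclidean g Φ)
    {X : (q : S) → TangentSpace (𝓡 2) q} (hX : IsHarmonicField g X) (p : S) :
    IsCoordHarmonic (Φ ∘ (extChartAt (𝓡 2) p).symm)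
      (fun z => fderiv ℝ (Φ ∘ (extChartAt (𝓡 2) p).symm) z (chartField p X z)) (base p) := by
  have hy := base_mem_target (m := 2) p
  have hXs := contDiffAt_chartField hX.smooth p
  obtain ⟨e, he⟩ := exists_frame (fderiv ℝ (Φ ∘ (extChartAt (𝓡 2) p).symm) (base p))
    (fun a ha => hΦ.fderiv_injective hy ha)
  refine isCoordHarmonic_of_frame he (fun a b => ?_) ?_
  · rw [← hΦ.innerCovDeriv_eq rfl hXs, ← hΦ.innerCovDeriv_eq rfl hXs]
    exact hX.closed p b a
  · have h1 := hX.coclosed p e (fun i j =>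
      (hΦ.inner_eq (p := p) (e i) (e j)).trans (he i j))
    rw [← h1]
    exact Finset.sum_congr rfl fun i _ => (hΦ.innerCovDeriv_eq rfl hXs (e i) (e i)).symm

/-- If `X` is harmonic, then `J X` is smooth and harmonic. -/
lemma isCoordHarmonic_complex_base (hΦ : IsIsometricImmersionEuclidean g Φ)
    {X : (q : S) → TangentSpace (𝓡 2) q} (hX : IsHarmonicField g X)
    {J : (q : S) → TangentSpace (𝓡 2) q →L[ℝ] TangentSpace (𝓡 2) q} (hJ : IsComplexStructure g J)
    (p : S) :
    ContDiffAt ℝ ∞ (chartField p (fun q => J q (X q))) (base p) ∧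
    IsCoordHarmonic (Φ ∘ (extChartAt (𝓡 2) p).symm)
      (fun z => fderiv ℝ (Φ ∘ (extChartAt (𝓡 2) p).symm) z (chartField p (fun q => J q (X q)) z))
      (base p) := by
  have hy := base_mem_target (m := 2) p
  have hXs := contDiffAt_chartField hX.smooth p
  have hJs := contDiffAt_chartEndo hJ.smooth p
  have hn := chart_target_mem_nhds hy
  have hev : ∀ᶠ z in 𝓝 (base p), chartField p (fun q => J q (X q)) z
      = chartEndo p J z (chartField p X z) := by
    filter_upwards [hn] with z hz
    rw [chartEndo_apply, chartField, chartField, fromChart_toChart hz]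
  have hsq : ∀ᶠ z in 𝓝 (base p), ∀ a, chartEndo p J z (chartEndo p J z a) = -a := by
    filter_upwards [hn] with z hz a
    rw [chartEndo_apply, chartEndo_apply, fromChart_toChart hz, hJ.sq]
    refine (map_neg (mfderiv (𝓡 2) 𝓘(ℝ, E 2) (extChartAt (𝓡 2) p) _) _).trans ?_
    exact congrArg Neg.neg (toChart_fromChart hz a)
  have hskew : ∀ᶠ z in 𝓝 (base p), ∀ a b,
      (inner ℝ (fderiv ℝ (Φ ∘ (extChartAt (𝓡 2) p).symm) z (chartEndo p J z a))
        (fderiv ℝ (Φ ∘ (extChartAt (𝓡 2) p).symm) z b) : ℝ)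
      = -inner ℝ (fderiv ℝ (Φ ∘ (extChartAt (𝓡 2) p).symm) z a)
        (fderiv ℝ (Φ ∘ (extChartAt (𝓡 2) p).symm) z (chartEndo p J z b)) := by
    filter_upwards [hn] with z hz a b
    rw [← hΦ.chartInner_eq hz, ← hΦ.chartInner_eq hz, chartInner, chartInner, chartEndo_apply,
      chartEndo_apply, fromChart_toChart hz, fromChart_toChart hz, hJ.skew]
  refine ⟨(hJs.clm_apply hXs).congr_of_eventuallyEq hev, ?_⟩
  have h1 : (fun z => fderiv ℝ (Φ ∘ (extChartAt (𝓡 2) p).symm) z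
      (chartEndo p J z (chartField p X z))) =ᶠ[𝓝 (base p)]
      (fun z => fderiv ℝ (Φ ∘ (extChartAt (𝓡 2) p).symm) z
        (chartField p (fun q => J q (X q)) z)) := by
    filter_upwards [hev] with z hz
    rw [hz]
  refine isCoordHarmonic_congr h1 ?_
  exact IsCoordHarmonic.complex (fun a ha => hΦ.fderiv_injective hy ha) hsq.self_of_nhds
    hskew.self_of_nhds
    (inner_fderiv_complex (hΦ.contDiffAt hy) hXs hJs hsq hskew) (isCoordHarmonic_base hΦ hX p)

lemma eventually_isCoordHarmonic (hΦ : IsIsometricImmersionEuclidean g Φ)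
    {Y : (q : S) → TangentSpace (𝓡 2) q}
    (hY : ∀ q, ContDiffAt ℝ ∞ (chartField q Y) (base q))
    (h : ∀ q, IsCoordHarmonic (Φ ∘ (extChartAt (𝓡 2) q).symm)
      (fun z => fderiv ℝ (Φ ∘ (extChartAt (𝓡 2) q).symm) z (chartField q Y z)) (base q)) (p : S) :
    ∀ᶠ z in 𝓝 (base p), IsCoordHarmonic (Φ ∘ (extChartAt (𝓡 2) p).symm)
      (fun z => fderiv ℝ (Φ ∘ (extChartAt (𝓡 2) p).symm) z (chartField p Y z)) z := by
  filter_upwards [chart_target_mem_nhds (base_mem_target (m := 2) p)] with z hz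
  refine isCoordHarmonic_congr (ambientField_comp_symm_eventuallyEq hΦ p Y hz) ?_
  refine isCoordHarmonic_of_base hΦ hz (mdifferentiableAt_ambientField hΦ (hY _)) ?_
  exact isCoordHarmonic_congr
    (ambientField_comp_symm_eventuallyEq hΦ _ Y (base_mem_target (m := 2) _)).symm (h _)

end Transfer
/-! ### Immersed surfaces and the Jacobi form -/

section Jacobi

variable {m n : ℕ}

lemma D2_clm_comp {k : ℕ} {V : E m → E k} {y : E m} (hV : ContDiffAt ℝ ∞ V y) (L : E k →L[ℝ] ℝ)
    (a b : E m) : D2 (fun z => L (V z)) y a b = L (D2 V y a b) := by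
  have hLV : ContDiffAt ℝ ∞ (fun z => L (V z)) y := L.contDiff.contDiffAt.comp y hV
  have h1 : ∀ᶠ z in 𝓝 y, ContDiffAt ℝ 1 V z :=
    (hV.of_le (by simp)).eventually (by simp)
  have h2 : (fun z => fderiv ℝ (fun z => L (V z)) z b) =ᶠ[𝓝 y] fun z => L (fderiv ℝ V z b) := by
    filter_upwards [h1] with z hz
    have := (L.hasFDerivAt.comp z (hz.differentiableAt (by simp)).hasFDerivAt).fderiv
    exact congrArg (fun T => T b) this
  have h3 : DifferentiableAt ℝ (fun z => fderiv ℝ V z b) y :=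
    (contDiffAt_fderiv_apply hV contDiffAt_const).differentiableAt (by simp)
  rw [← fderiv_fderiv_apply hLV, h2.fderiv_eq]
  have h4 := (L.hasFDerivAt.comp y h3.hasFDerivAt).fderiv
  have h5 := congrArg (fun T => T a) h4
  refine Eq.trans h5 ?_
  rw [← fderiv_fderiv_apply hV]
  rfl

/-- Parseval's identity for a normal vector `w`: `u` and `ν` are orthonormal bases of the tangent
and of the normal space. -/
lemma sum_sq_inner_normal {k : ℕ} (hk : k ≤ n) {u : Fin k → E n} (hu : Orthonormal ℝ u)
    {ν : Fin (n - k) → E n} (hν : Orthonormal ℝ ν) (huν : ∀ a b, inner ℝ (u a) (ν b) = (0 : ℝ))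
    {w : E n} (hw : ∀ a, inner ℝ w (u a) = (0 : ℝ)) :
    ∑ b, (inner ℝ w (ν b) : ℝ) ^ 2 = inner ℝ w w := by
  have ho : Orthonormal ℝ (Sum.elim u ν) := by
    rw [orthonormal_iff_ite]
    rintro (a | a) (b | b)
    · simpa using! orthonormal_iff_ite.1 hu a b
    · simpa using huν a b
    · simpa [real_inner_comm] using huν b a
    · simpa using! orthonormal_iff_ite.1 hν a b
  have hcard : Fintype.card (Fin k ⊕ Fin (n - k)) = Module.finrank ℝ (E n) := by
    simp; omega
  let b := basisOfLinearIndependentOfCardEqFinrank' _ ho.linearIndependent hcard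
  have hb : (b : Fin k ⊕ Fin (n - k) → E n) = Sum.elim u ν :=
    coe_basisOfLinearIndependentOfCardEqFinrank' _ _ _
  let b' := b.toOrthonormalBasis (by rw [hb]; exact ho)
  have hb' : (b' : Fin k ⊕ Fin (n - k) → E n) = Sum.elim u ν := by
    rw [← hb]; exact b.coe_toOrthonormalBasis _
  have h := b'.sum_inner_mul_inner w w
  rw [Fintype.sum_sum_type] at h
  simp only [hb', Sum.elim_inl, Sum.elim_inr, hw, zero_mul, Finset.sum_const_zero, zero_add] at h
  rw [← h]
  refine Finset.sum_congr rfl fun c _ => ?_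
  rw [real_inner_comm w (ν c), sq]

end Jacobi

section Immersion

variable {m k n : ℕ} {S M : Type*} [TopologicalSpace S] [ChartedSpace (E m) S]
  [TopologicalSpace M] [ChartedSpace (E k) M] [IsManifold (𝓡 m) ∞ S] [IsManifold (𝓡 k) ∞ M]
  {gS : RMetric m S} {gM : RMetric k M} {ψ : S → M} {φ : M → E n}

lemma mvfderiv_comp_immersion (hφ : IsIsometricImmersionEuclidean gM φ)
    (hψ : IsIsometricImmersion gS gM ψ) (q : S) (v : TangentSpace (𝓡 m) q) :
    mvfderiv (𝓡 m) (φ ∘ ψ) q v = mvfderiv (𝓡 k) φ (ψ q) (mfderiv (𝓡 m) (𝓡 k) ψ q v) := by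
  have h := mfderiv_comp q (hφ.smooth.mdifferentiable (by simp) (ψ q))
    (hψ.smooth.mdifferentiable (by simp) q)
  exact congrArg (fun L => L v) h

/-- The composition of isometric immersions is isometric. -/
lemma IsIsometricImmersionEuclidean.comp (hφ : IsIsometricImmersionEuclidean gM φ)
    (hψ : IsIsometricImmersion gS gM ψ) : IsIsometricImmersionEuclidean gS (φ ∘ ψ) where
  smooth := hφ.smooth.comp hψ.smooth
  isometric q v w := by
    rw [mvfderiv_comp_immersion hφ hψ, mvfderiv_comp_immersion hφ hψ, hφ.isometric, hψ.isometric]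

lemma mfderiv_eq_fderiv_chartMap (hψ : IsIsometricImmersion gS gM ψ) (p : S)
    (v : E m) : mfderiv (𝓡 m) (𝓡 k) ψ p v
      = fderiv ℝ (chartMap (m := m) (k := k) ψ p) (base (m := m) p) v := by
  have h := (hψ.smooth.mdifferentiable (by simp) p).mfderiv
  have hr : Set.range (𝓡 m) = Set.univ := by simp
  rw [hr, fderivWithin_univ] at h
  exact congrArg (fun L => L v) h

omit [IsManifold (𝓡 m) ∞ S] [IsManifold (𝓡 k) ∞ M] in
lemma chartMap_base (ψ : S → M) (p : S) :
    chartMap (m := m) (k := k) ψ p (base (m := m) p) = base (m := k) (ψ p) := by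
  rw [chartMap, symm_base]; rfl

lemma eventually_chart (hψ : IsIsometricImmersion gS gM ψ) (p : S) :
    ∀ᶠ z in 𝓝 (base (m := m) p), z ∈ (extChartAt (𝓡 m) p).target ∧
      ψ ((extChartAt (𝓡 m) p).symm z) ∈ (extChartAt (𝓡 k) (ψ p)).source := by
  have hy := base_mem_target (m := m) p
  have h1 : ContinuousAt (ψ ∘ (extChartAt (𝓡 m) p).symm) (base (m := m) p) := by
    refine ContinuousAt.comp ?_ ((continuousOn_extChartAt_symm p).continuousAt
      (chart_target_mem_nhds hy))
    exact hψ.smooth.continuous.continuousAt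
  have h2 : (extChartAt (𝓡 k) (ψ p)).source
      ∈ 𝓝 ((ψ ∘ (extChartAt (𝓡 m) p).symm) (base (m := m) p)) := by
    rw [Function.comp, symm_base]
    exact extChartAt_source_mem_nhds (ψ p)
  filter_upwards [chart_target_mem_nhds hy, h1 h2] with z hz1 hz2 using ⟨hz1, hz2⟩

lemma eventually_contDiffAt_chartMap (hψ : IsIsometricImmersion gS gM ψ) (p : S) :
    ∀ᶠ z in 𝓝 (base (m := m) p), ContDiffAt ℝ ∞ (chartMap (m := m) (k := k) ψ p) z := by
  filter_upwards [eventually_chart hψ p] with z hz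
  have h1 : ContMDiffAt 𝓘(ℝ, E m) (𝓡 m) ∞ (extChartAt (𝓡 m) p).symm z :=
    (contMDiffOn_extChartAt_symm (I := 𝓡 m) (n := ∞) p).contMDiffAt (chart_target_mem_nhds hz.1)
  have h2 := (hψ.smooth ((extChartAt (𝓡 m) p).symm z)).comp z h1
  have h3 : ContMDiffAt (𝓡 k) 𝓘(ℝ, E k) ∞ (extChartAt (𝓡 k) (ψ p))
      (ψ ((extChartAt (𝓡 m) p).symm z)) :=
    contMDiffAt_extChartAt' (by rw [← extChartAt_source (I := 𝓡 k)]; exact hz.2)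
  exact contMDiffAt_iff_contDiffAt.1 (h3.comp z h2)

lemma comp_chartMap_eventuallyEq (hψ : IsIsometricImmersion gS gM ψ) (φ : M → E n) (p : S) :
    (φ ∘ ψ) ∘ (extChartAt (𝓡 m) p).symm =ᶠ[𝓝 (base (m := m) p)]
      (φ ∘ (extChartAt (𝓡 k) (ψ p)).symm) ∘ chartMap (m := m) (k := k) ψ p := by
  filter_upwards [eventually_chart hψ p] with z hz
  exact congrArg φ ((extChartAt (𝓡 k) (ψ p)).left_inv hz.2).symm

lemma fderiv_comp_chartMap (hφ : IsIsometricImmersionEuclidean gM φ)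
    (hψ : IsIsometricImmersion gS gM ψ) {p : S} {F : E m → E n} {G : E k → E n}
    (hF : F = (φ ∘ ψ) ∘ (extChartAt (𝓡 m) p).symm) (hG : G = φ ∘ (extChartAt (𝓡 k) (ψ p)).symm)
    (v : E m) : fderiv ℝ F (base p) v = fderiv ℝ G (base (ψ p))
      (fderiv ℝ (chartMap (m := m) (k := k) ψ p) (base p) v) := by
  have hc := (eventually_contDiffAt_chartMap hψ p).self_of_nhds
  have hGs : ContDiffAt ℝ ∞ G (base (ψ p)) := hG ▸ hφ.contDiffAt (base_mem_target (ψ p))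
  rw [hF, (comp_chartMap_eventuallyEq (k := k) hψ φ p).fderiv_eq, ← hG, fderiv_comp _
    (by rw [chartMap_base]; exact hGs.differentiableAt (by simp))
    (hc.differentiableAt (by simp)), chartMap_base]
  rfl

lemma D2_comp_chartMap (hφ : IsIsometricImmersionEuclidean gM φ)
    (hψ : IsIsometricImmersion gS gM ψ) {p : S} {F : E m → E n} {G : E k → E n}
    (hF : F = (φ ∘ ψ) ∘ (extChartAt (𝓡 m) p).symm) (hG : G = φ ∘ (extChartAt (𝓡 k) (ψ p)).symm)
    (v w : E m) : D2 F (base p) v w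
      = D2 G (base (ψ p)) (fderiv ℝ (chartMap (m := m) (k := k) ψ p) (base p) v)
          (fderiv ℝ (chartMap (m := m) (k := k) ψ p) (base p) w)
        + fderiv ℝ G (base (ψ p)) (D2 (chartMap (m := m) (k := k) ψ p) (base p) v w) := by
  have hc := eventually_contDiffAt_chartMap hψ p
  have hGs : ∀ᶠ z in 𝓝 (base (ψ p)), ContDiffAt ℝ ∞ G z := by
    filter_upwards [chart_target_mem_nhds (base_mem_target (m := k) (ψ p))] with z hz
    exact hG ▸ hφ.contDiffAt hz
  have h := comp_chartMap_eventuallyEq (k := k) hψ φ p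
  rw [← chartMap_base (m := m) (k := k)] at hGs
  have h2 := D2_comp hGs hc v w
  rw [chartMap_base] at h2
  rw [← h2, hF, D2, D2, h.fderiv.fderiv_eq, hG]

/-- The second fundamental form of `S` in `M` is `⟨D²F, N⟩`, with `F` the immersion of `S` in `ℝⁿ`. -/
lemma sffMatrix_eq (hφ : IsIsometricImmersionEuclidean gM φ)
    (hψ : IsIsometricImmersion gS gM ψ) {p : S} {F : E m → E n} {G : E k → E n}
    (hF : F = (φ ∘ ψ) ∘ (extChartAt (𝓡 m) p).symm) (hG : G = φ ∘ (extChartAt (𝓡 k) (ψ p)).symm)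
    (N : (q : S) → TangentSpace (𝓡 k) (ψ q)) (i j : Fin m) :
    sffMatrix gM ψ N p i j = inner ℝ (D2 F (base p) (stdVec i) (stdVec j))
      (fderiv ℝ G (base (ψ p)) (N p)) := by
  have hy := base_mem_target (m := k) (ψ p)
  have hc := (eventually_contDiffAt_chartMap hψ p).self_of_nhds
  change chartInner gM (ψ p) (base (m := k) (ψ p))
    (fderiv ℝ (fun z => fderiv ℝ (chartMap (m := m) (k := k) ψ p) z (stdVec j)) (base (m := m) p)
        (stdVec i)
      + christoffelVec gM (ψ p) (base (m := k) (ψ p))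
        (fderiv ℝ (chartMap (m := m) (k := k) ψ p) (base (m := m) p) (stdVec i))
        (fderiv ℝ (chartMap (m := m) (k := k) ψ p) (base (m := m) p) (stdVec j)))
    (toChart (ψ p) (ψ p) (N p)) = _
  rw [hφ.chartInner_eq hy, ← hG, toChart_self, fderiv_fderiv_apply hc, map_add, inner_add_left]
  refine (congrArg _ (hφ.inner_christoffelVec hy hG _ _ (N p))).trans ?_
  rw [← inner_add_left, D2_comp_chartMap hφ hψ hF hG, add_comm]

/-- The traces of `A` and `A²` computed from the matrix `h` of the second fundamental form in an
orthonormal frame. -/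
lemma trace_shapeMatrix (hφ : IsIsometricImmersionEuclidean gM φ)
    (hψ : IsIsometricImmersion gS gM ψ) {p : S} {F : E m → E n} {G : E k → E n}
    (hF : F = (φ ∘ ψ) ∘ (extChartAt (𝓡 m) p).symm) (hG : G = φ ∘ (extChartAt (𝓡 k) (ψ p)).symm)
    (N : (q : S) → TangentSpace (𝓡 k) (ψ q)) {e : Fin m → E m}
    (he : ∀ a b, inner ℝ (fderiv ℝ F (base p) (e a)) (fderiv ℝ F (base p) (e b))
      = if a = b then (1 : ℝ) else 0)
    {h : Matrix (Fin m) (Fin m) ℝ}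
    (hh : ∀ a b, h a b = inner ℝ (D2 F (base p) (e a) (e b)) (fderiv ℝ G (base (ψ p)) (N p))) :
    (shapeMatrix gS gM ψ N p).trace = h.trace ∧
      shapeNormSq gS gM ψ N p = (h * h).trace := by
  have hΦ := hφ.comp hψ
  set P : Matrix (Fin m) (Fin m) ℝ := Matrix.of fun i a => e a i with hP
  have hg : (gram gS p (base p))⁻¹ = P * P.transpose := by
    ext i j
    rw [hΦ.gram_inv (base_mem_target p) hF he, Matrix.mul_apply]
    rfl
  have hm : h = P.transpose * sffMatrix gM ψ N p * P := by
    ext a b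
    rw [hh, D2_eq_sum, sum_inner, Matrix.mul_apply]
    simp only [sum_inner, inner_smul_left, ← sffMatrix_eq hφ hψ hF hG N, Matrix.mul_apply,
      Finset.sum_mul, conj_trivial]
    rw [Finset.sum_comm]
    refine Finset.sum_congr rfl fun i _ => Finset.sum_congr rfl fun j _ => ?_
    simp only [hP, Matrix.transpose_apply, Matrix.of_apply]
    ring
  constructor
  · rw [shapeMatrix, hg, hm, Matrix.mul_assoc, Matrix.trace_mul_comm, Matrix.mul_assoc]
  · rw [shapeNormSq, shapeMatrix, hg, hm]
    simp only [Matrix.mul_assoc]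
    rw [Matrix.trace_mul_comm]
    simp only [Matrix.mul_assoc]

end Immersion

section JacobiField

variable {m k n : ℕ} {S M : Type*} [TopologicalSpace S] [ChartedSpace (E m) S]
  [TopologicalSpace M] [ChartedSpace (E k) M] [IsManifold (𝓡 m) ∞ S] [IsManifold (𝓡 k) ∞ M]
  {gS : RMetric m S} {gM : RMetric k M} {ψ : S → M} {φ : M → E n}

lemma D2_congr {W : Type*} [NormedAddCommGroup W] [NormedSpace ℝ W] {F F' : E m → W} {y : E m}
    (h : F =ᶠ[𝓝 y] F') (a b : E m) : D2 F y a b = D2 F' y a b := by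
  rw [D2, D2, h.fderiv.fderiv_eq]

/-- `Q(Y, Y) = ⟨V, ΔV⟩ + (Ric(N, N) + ‖A‖²) |V|²`, where `V` is the field `Y` seen in `ℝⁿ`. -/
lemma jacobiQField_eq (hφ : IsIsometricImmersionEuclidean gM φ)
    (hψ : IsIsometricImmersion gS gM ψ) {p : S} {F : E m → E n}
    (hF : F = (φ ∘ ψ) ∘ (extChartAt (𝓡 m) p).symm)
    (N : (q : S) → TangentSpace (𝓡 k) (ψ q)) {e : Fin m → E m}
    (he : ∀ a b, inner ℝ (fderiv ℝ F (base p) (e a)) (fderiv ℝ F (base p) (e b))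
      = if a = b then (1 : ℝ) else 0)
    {Y : (q : S) → TangentSpace (𝓡 m) q} (hY : ContDiffAt ℝ ∞ (chartField p Y) (base p))
    {V : E m → E n} (hV : V = fun z => fderiv ℝ F z (chartField p Y z)) :
    jacobiQField gS gM ψ φ N Y p
      = inner ℝ (V (base p)) (∑ a, (D2 V (base p) (e a) (e a)
          - fderiv ℝ V (base p) (christoffelVec gS p (base p) (e a) (e a))))
        + (ricci gM (ψ p) (N p) (N p) + shapeNormSq gS gM ψ N p)
          * inner ℝ (V (base p)) (V (base p)) := by
  have hΦ := hφ.comp hψ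
  have hy := base_mem_target (m := m) p
  have hVs : ContDiffAt ℝ ∞ V (base p) := by
    rw [hV, hF]; exact contDiffAt_fderiv_apply (hΦ.contDiffAt hy) hY
  have hu : ∀ i, coordFun (m := m) (k := k) ψ φ Y i ∘ (extChartAt (𝓡 m) p).symm
      =ᶠ[𝓝 (base p)] fun z => EuclideanSpace.proj (𝕜 := ℝ) i (V z) := by
    intro i
    filter_upwards [chart_target_mem_nhds hy] with z hz
    simp only [hV, hF]
    rw [hΦ.fderiv_chartField p hz, mvfderiv_comp_immersion hφ hψ]
    rfl
  have hp : ∀ i, coordFun (m := m) (k := k) ψ φ Y i p = V (base p) i := by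
    intro i
    have := (hu i).self_of_nhds
    rw [Function.comp, symm_base] at this
    exact this
  have hL : ∀ i, laplacian gS (coordFun (m := m) (k := k) ψ φ Y i) p
      = (∑ a, (D2 V (base p) (e a) (e a)
          - fderiv ℝ V (base p) (christoffelVec gS p (base p) (e a) (e a)))) i := by
    intro i
    have hs : ContDiffAt ℝ ∞ (fun z => EuclideanSpace.proj (𝕜 := ℝ) i (V z)) (base p) :=
      (EuclideanSpace.proj (𝕜 := ℝ) i).contDiff.contDiffAt.comp _ hVs
    rw [hΦ.laplacian_eq hF he (hs.congr_of_eventuallyEq (hu i))]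
    have h1 : ∀ c, fderiv ℝ (fun z => EuclideanSpace.proj (𝕜 := ℝ) i (V z)) (base p) c
        = (fderiv ℝ V (base p) c) i := by
      intro c
      have := ((EuclideanSpace.proj (𝕜 := ℝ) i).hasFDerivAt.comp (base p)
        (hVs.differentiableAt (by simp)).hasFDerivAt).fderiv
      exact congrArg (fun T => T c) this
    simp only [D2_congr (hu i), (hu i).fderiv_eq, h1, D2_clm_comp hVs]
    simp
  simp only [jacobiQField, jacobiQ, hp, hL, Finset.sum_add_distrib, ← Finset.mul_sum]
  congr 1
  · rw [PiLp.inner_apply]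
    exact Finset.sum_congr rfl fun i _ => by simp [mul_comm]
  · rw [PiLp.inner_apply]
    congr 1
    exact Finset.sum_congr rfl fun i _ => by simp [sq]

end JacobiField

section Final

variable {n : ℕ}

/-- The relations between the components of a plane vector and of its image under a rotation
by a right angle. -/
lemma rotation_relations {α β α' β' : ℝ} (h1 : α' ^ 2 + β' ^ 2 = α ^ 2 + β ^ 2)
    (h2 : α * α' + β * β' = 0) :
    α' ^ 2 = β ^ 2 ∧ β' ^ 2 = α ^ 2 ∧ α' * β' = - (α * β) := by
  by_cases h0 : α ^ 2 + β ^ 2 = 0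
  · have ha : α = 0 := by nlinarith [sq_nonneg α, sq_nonneg β]
    have hb : β = 0 := by nlinarith [sq_nonneg α, sq_nonneg β]
    subst ha hb
    have ha' : α' = 0 := by nlinarith [sq_nonneg α', sq_nonneg β']
    have hb' : β' = 0 := by nlinarith [sq_nonneg α', sq_nonneg β']
    subst ha' hb'
    simp
  · refine ⟨mul_left_cancel₀ h0 ?_, mul_left_cancel₀ h0 ?_, mul_left_cancel₀ h0 ?_⟩
    · linear_combination β ^ 2 * h1 + (α * α' - β * β') * h2
    · linear_combination α ^ 2 * h1 - (α * α' - β * β') * h2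
    · linear_combination - α * β * h1 + (α * β' + β * α') * h2

/-- For the Gauss form in dimension three the scalar curvature is `2 K₁₂ + 2 Ric(f₃, f₃)`. -/
lemma sum_gaussForm_three {B : E 3 →ₗ[ℝ] E 3 →ₗ[ℝ] E n} (hB : ∀ v w, B v w = B w v)
    (f : Fin 3 → E 3) :
    ∑ b, ∑ a, gaussForm B (f b) (f b) (f a) (f a)
      = 2 * (inner ℝ (B (f 0) (f 0)) (B (f 1) (f 1)) - inner ℝ (B (f 0) (f 1)) (B (f 0) (f 1)))
        + 2 * ∑ a, gaussForm B (f 2) (f 2) (f a) (f a) := by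
  simp only [gaussForm, Fin.sum_univ_three]
  rw [hB (f 1) (f 0), hB (f 2) (f 0), hB (f 2) (f 1),
    real_inner_comm (B (f 0) (f 0)) (B (f 1) (f 1)),
    real_inner_comm (B (f 0) (f 0)) (B (f 2) (f 2)),
    real_inner_comm (B (f 1) (f 1)) (B (f 2) (f 2))]
  ring

lemma chartField_base {m : ℕ} {M : Type*} [TopologicalSpace M] [ChartedSpace (E m) M]
    [IsManifold (𝓡 m) ∞ M] (p : M) (Y : (q : M) → TangentSpace (𝓡 m) q) :
    chartField p Y (base p) = Y p := by
  have h : ∀ q, q = p → (toChart p q (Y q) : E m) = Y p := by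
    rintro q rfl
    exact toChart_self q (Y q)
  exact h _ (symm_base p)

/-- The normal part with respect to a surface is the normal part with respect to the ambient
three-manifold plus the component along the unit normal. -/
lemma normalPart_three {u : Fin 2 → E n} {u' : Fin 3 → E n} (h0 : u' 0 = u 0) (h1 : u' 1 = u 1)
    (v : E n) : normalPart u v = normalPart u' v + (inner ℝ v (u' 2) : ℝ) • u' 2 := by
  simp only [normalPart, Fin.sum_univ_two, Fin.sum_univ_three, h0, h1]
  abel

end Final

end RiemGeom

open RiemGeom in
theorem mainTheorem12
    {n : ℕ} (hn : 4 ≤ n)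
    {M : Type*} [TopologicalSpace M] [ChartedSpace (E 3) M] [IsManifold (𝓡 3) ∞ M]
    {S : Type*} [TopologicalSpace S] [ChartedSpace (E 2) S] [IsManifold (𝓡 2) ∞ S]
    (gM : RMetric 3 M) (gS : RMetric 2 S)
    (φ : M → E n) (hφ : IsIsometricImmersionEuclidean gM φ)
    (ψ : S → M) (hψ : IsIsometricImmersion gS gM ψ)
    (N : (q : S) → TangentSpace (𝓡 3) (ψ q)) (hN : IsUnitNormal (m := 2) gM ψ N)
    (H : ℝ) (hH : ∀ q : S, meanCurvature gS gM ψ N q = H)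
    (J : (q : S) → TangentSpace (𝓡 2) q →L[ℝ] TangentSpace (𝓡 2) q)
    (hJ : IsComplexStructure gS J)
    (X : (q : S) → TangentSpace (𝓡 2) q) (hX : IsHarmonicField gS X)
    (p : S) (e : Fin 2 → TangentSpace (𝓡 2) p) (he : IsOrthonormalAt gS p e)
    (ν : Fin (n - 3) → E n) (hν : IsNormalBasisAt φ (ψ p) ν) :
    jacobiQField gS gM ψ φ N X p + jacobiQField gS gM ψ φ N (fun q => J q (X q)) p =
      (4 * H ^ 2 + 6 * normScal gM (ψ p)) * gS.inner p (X p) (X p)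
        - ∑ a : Fin (n - 3), ∑ i : Fin 2,
          (euclideanSFF φ (ν a) (ψ p) (mfderiv (𝓡 2) (𝓡 3) ψ p (e i))
              (mfderiv (𝓡 2) (𝓡 3) ψ p (X p)) ^ 2
            + euclideanSFF φ (ν a) (ψ p) (mfderiv (𝓡 2) (𝓡 3) ψ p (e i))
              (mfderiv (𝓡 2) (𝓡 3) ψ p (J p (X p))) ^ 2) := by
  have hΦ := hφ.comp hψ
  have hy := base_mem_target (m := 2) p
  have hy' := base_mem_target (m := 3) (ψ p)
  obtain ⟨F, hF⟩ : ∃ F, F = (φ ∘ ψ) ∘ (extChartAt (𝓡 2) p).symm := ⟨_, rfl⟩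
  obtain ⟨G, hG⟩ : ∃ G, G = φ ∘ (extChartAt (𝓡 3) (ψ p)).symm := ⟨_, rfl⟩
  have hFs : ContDiffAt ℝ ∞ F (base p) := hF ▸ hΦ.contDiffAt hy
  have hGs : ContDiffAt ℝ ∞ G (base (ψ p)) := hG ▸ hφ.contDiffAt hy'
  obtain ⟨ε, hε⟩ : ∃ ε : Fin 2 → E 2, ε = e := ⟨_, rfl⟩
  obtain ⟨η, hη⟩ : ∃ η : E 3, η = N p := ⟨_, rfl⟩
  obtain ⟨C, hC⟩ : ∃ C : E 2 →L[ℝ] E 3, C = fderiv ℝ (chartMap (m := 2) (k := 3) ψ p) (base p) :=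
    ⟨_, rfl⟩
  have hψC : ∀ v : E 2, mfderiv (𝓡 2) (𝓡 3) ψ p v = C v := fun v => by
    rw [hC]; exact mfderiv_eq_fderiv_chartMap hψ p v
  have hFC : ∀ v, fderiv ℝ F (base p) v = fderiv ℝ G (base (ψ p)) (C v) := fun v => by
    rw [hC]; exact fderiv_comp_chartMap hφ hψ hF hG v
  -- the pushed-forward frame `e₁, e₂` of the surface, completed by the normal, is a frame of `M`
  have heF : ∀ i j, inner ℝ (fderiv ℝ F (base p) (ε i)) (fderiv ℝ F (base p) (ε j))
      = if i = j then (1 : ℝ) else 0 := by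
    intro i j
    rw [hF, hε]
    exact (hΦ.inner_eq (p := p) (e i) (e j)).symm.trans (he i j)
  have hηη : inner ℝ (fderiv ℝ G (base (ψ p)) η) (fderiv ℝ G (base (ψ p)) η) = (1 : ℝ) := by
    rw [hG, hη]
    exact (hφ.inner_eq (p := ψ p) (N p) (N p)).symm.trans (hN.unit p)
  have hCη : ∀ v : E 2, inner ℝ (fderiv ℝ G (base (ψ p)) (C v)) (fderiv ℝ G (base (ψ p)) η)
      = (0 : ℝ) := by
    intro v
    rw [hG, hη, ← hψC]
    exact (hφ.inner_eq (p := ψ p) (mfderiv (𝓡 2) (𝓡 3) ψ p v) (N p)).symm.trans (hN.normal p v)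
  have hηC : ∀ v : E 2, inner ℝ (fderiv ℝ G (base (ψ p)) η) (fderiv ℝ G (base (ψ p)) (C v))
      = (0 : ℝ) := fun v => by rw [real_inner_comm]; exact hCη v
  obtain ⟨f, hf⟩ : ∃ f : Fin 3 → E 3, f = ![C (ε 0), C (ε 1), η] := ⟨_, rfl⟩
  have hff : ∀ a b, inner ℝ (fderiv ℝ G (base (ψ p)) (f a)) (fderiv ℝ G (base (ψ p)) (f b))
      = if a = b then (1 : ℝ) else 0 := by
    have h00 := heF 0 0
    have h01 := heF 0 1
    have h10 := heF 1 0
    have h11 := heF 1 1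
    simp only [hFC] at h00 h01 h10 h11
    intro a b
    rw [hf]
    fin_cases a <;> fin_cases b
    · simpa using h00
    · simpa using h01
    · simpa using hCη (ε 0)
    · simpa using h10
    · simpa using h11
    · simpa using hCη (ε 1)
    · simpa using hηC (ε 0)
    · simpa using hηC (ε 1)
    · simpa using hηη
  have hf0 : f 0 = C (ε 0) := by rw [hf]; rfl
  have hf1 : f 1 = C (ε 1) := by rw [hf]; rfl
  have hf2 : f 2 = η := by rw [hf]; rfl
  obtain ⟨u, hu⟩ : ∃ u : Fin 3 → E n, u = fun a => fderiv ℝ G (base (ψ p)) (f a) := ⟨_, rfl⟩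
  have hua : ∀ a, u a = fderiv ℝ G (base (ψ p)) (f a) := fun a => by rw [hu]
  have huo : Orthonormal ℝ u := hu ▸ orthonormal_of_frame hff
  obtain ⟨B, hB⟩ : ∃ B : E 3 →ₗ[ℝ] E 3 →ₗ[ℝ] E n, B = normalHess u G (base (ψ p)) := ⟨_, rfl⟩
  have hBsymm : ∀ v w, B v w = B w v := fun v w => by
    rw [hB, normalHess_apply, normalHess_apply, D2_comm hGs]
  have hBu : ∀ v w a, inner ℝ (B v w) (u a) = (0 : ℝ) := fun v w a => by
    rw [hB]; exact inner_normalPart huo _ a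
  obtain ⟨h, hh⟩ : ∃ h : Matrix (Fin 2) (Fin 2) ℝ,
      ∀ a b, h a b = inner ℝ (D2 F (base p) (ε a) (ε b)) (u 2) :=
    ⟨Matrix.of fun a b => inner ℝ (D2 F (base p) (ε a) (ε b)) (u 2), fun _ _ => rfl⟩
  have hhsymm : h 1 0 = h 0 1 := by rw [hh, hh, D2_comm hFs]
  have hBS : ∀ a b, normalPart (fun i => fderiv ℝ F (base p) (ε i)) (D2 F (base p) a b)
      = B (C a) (C b) + (inner ℝ (D2 F (base p) a b) (u 2) : ℝ) • u 2 := by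
    intro a b
    rw [normalPart_three (u := fun i => fderiv ℝ F (base p) (ε i)) (u' := u)
      (by rw [hua, hFC, hf0]) (by rw [hua, hFC, hf1])]
    congr 1
    rw [D2_comp_chartMap hφ hψ hF hG, ← hC, normalPart_add, hu, normalPart_map hff, add_zero, hB,
      hu]
    rfl
  have hRic : ricci gM (ψ p) (N p) (N p) = ∑ a, gaussForm B (f 2) (f 2) (f a) (f a) := by
    rw [hB, hu, hf2, hη]
    exact hφ.ricci_eq hG hff (N p) (N p)
  have hScal : 6 * normScal gM (ψ p) = ∑ b, ∑ a, gaussForm B (f b) (f b) (f a) (f a) := by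
    rw [hφ.normScal_eq hG hff, hB, hu]
    simp only [hφ.ricci_eq hG hff]
    push_cast
    ring
  obtain ⟨htr, hnorm⟩ := trace_shapeMatrix hφ hψ hF hG N heF (h := h)
    (fun a b => by rw [hh, hua, hf2, hη])
  have hH' : h 0 0 + h 1 1 = 2 * H := by
    rw [← hH p, meanCurvature, htr, Matrix.trace_fin_two]
    push_cast
    ring
  have hA : shapeNormSq gS gM ψ N p = h 0 0 ^ 2 + 2 * h 0 1 ^ 2 + h 1 1 ^ 2 := by
    rw [hnorm, Matrix.trace_fin_two, Matrix.mul_apply, Matrix.mul_apply, Fin.sum_univ_two,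
      Fin.sum_univ_two, hhsymm]
    ring
  obtain ⟨b00, hb00⟩ : ∃ b : E n, b = B (C (ε 0)) (C (ε 0)) := ⟨_, rfl⟩
  obtain ⟨b01, hb01⟩ : ∃ b : E n, b = B (C (ε 0)) (C (ε 1)) := ⟨_, rfl⟩
  obtain ⟨b11, hb11⟩ : ∃ b : E n, b = B (C (ε 1)) (C (ε 1)) := ⟨_, rfl⟩
  have hu22 : inner ℝ (u 2) (u 2) = (1 : ℝ) := by rw [hua, hf2]; exact hηη
  have hinner : ∀ x x' : E n, ∀ r r' : ℝ, inner ℝ x (u 2) = (0 : ℝ) → inner ℝ x' (u 2) = (0 : ℝ) →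
      (inner ℝ (x + r • u 2) (x' + r' • u 2) : ℝ) = inner ℝ x x' + r * r' := by
    intro x x' r r' hx hx'
    have hx'' : inner ℝ (u 2) x' = (0 : ℝ) := by rw [real_inner_comm]; exact hx'
    simp only [inner_add_left, inner_add_right, inner_smul_left, inner_smul_right, hx, hx'', hu22,
      conj_trivial]
    ring
  have key : ∀ (Y : (q : S) → TangentSpace (𝓡 2) q), ContDiffAt ℝ ∞ (chartField p Y) (base p) →
      (∀ᶠ z in nhds (base p), IsCoordHarmonic F (fun z => fderiv ℝ F z (chartField p Y z)) z) →
      ∀ α β : ℝ, (Y p : E 2) = α • ε 0 + β • ε 1 →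
      jacobiQField gS gM ψ φ N Y p
        = (inner ℝ b00 b11 - inner ℝ b01 b01 + (h 0 0 * h 1 1 - h 0 1 ^ 2)
            + ricci gM (ψ p) (N p) (N p) + shapeNormSq gS gM ψ N p) * (α ^ 2 + β ^ 2)
          - inner ℝ (α • b00 + β • b01) (α • b00 + β • b01)
          - inner ℝ (α • b01 + β • b11) (α • b01 + β • b11)
          - (α * h 0 0 + β * h 0 1) ^ 2 - (α * h 0 1 + β * h 1 1) ^ 2 := by
    intro Y hY hharm α β hαβ
    have hγ : ∀ w, (inner ℝ (fderiv ℝ F (base p)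
          (christoffelVec gS p (base p) (ε 0) (ε 0) + christoffelVec gS p (base p) (ε 1) (ε 1)))
          (fderiv ℝ F (base p) w) : ℝ)
        = inner ℝ (D2 F (base p) (ε 0) (ε 0) + D2 F (base p) (ε 1) (ε 1))
          (fderiv ℝ F (base p) w) := by
      intro w
      rw [map_add, inner_add_left, inner_add_left, hΦ.inner_christoffelVec hy hF,
        hΦ.inner_christoffelVec hy hF]
    have hx : chartField p Y (base p) = α • ε 0 + β • ε 1 := (chartField_base p Y).trans hαβ
    have hbo := bochner rfl rfl hFs hY heF hγ hharm
    rw [jacobiQField_eq hφ hψ hF N heF hY rfl, Fin.sum_univ_two]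
    have hnn : (inner ℝ (fderiv ℝ F (base p) (chartField p Y (base p)))
        (fderiv ℝ F (base p) (chartField p Y (base p))) : ℝ) = α ^ 2 + β ^ 2 := by
      rw [hx]
      simp only [map_add, map_smul, inner_add_left, inner_add_right, inner_smul_left,
        inner_smul_right, heF, conj_trivial]
      simp
      ring
    have hBx : ∀ i, normalPart (fun i => fderiv ℝ F (base p) (ε i))
          (D2 F (base p) (ε i) (chartField p Y (base p)))
        = (α • B (C (ε i)) (C (ε 0)) + β • B (C (ε i)) (C (ε 1)))
          + (α * h i 0 + β * h i 1) • u 2 := by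
      intro i
      rw [hBS, hx, D2_add_right, D2_smul_right, D2_smul_right, inner_add_left, inner_smul_left,
        inner_smul_left, hh, hh]
      simp only [map_add, map_smul, conj_trivial]
    have hlin : ∀ v w w', inner ℝ (α • B v w + β • B v w') (u 2) = (0 : ℝ) := by
      intro v w w'
      rw [inner_add_left, inner_smul_left, inner_smul_left, hBu, hBu]; simp
    simp only [hBx, hBS, ← hh, hnn, hinner _ _ _ _ (hBu _ _ _) (hBu _ _ _),
      hinner _ _ _ _ (hlin _ _ _) (hlin _ _ _)] at hbo
    rw [hBsymm (C (ε 1)) (C (ε 0)), hhsymm, ← hb00, ← hb01, ← hb11] at hbo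
    rw [hnn]
    have hsum : D2 (fun z => fderiv ℝ F z (chartField p Y z)) (base p) (ε 0) (ε 0)
          - fderiv ℝ (fun z => fderiv ℝ F z (chartField p Y z)) (base p)
            (christoffelVec gS p (base p) (ε 0) (ε 0))
        + (D2 (fun z => fderiv ℝ F z (chartField p Y z)) (base p) (ε 1) (ε 1)
          - fderiv ℝ (fun z => fderiv ℝ F z (chartField p Y z)) (base p)
            (christoffelVec gS p (base p) (ε 1) (ε 1)))
        = D2 (fun z => fderiv ℝ F z (chartField p Y z)) (base p) (ε 0) (ε 0)
          + D2 (fun z => fderiv ℝ F z (chartField p Y z)) (base p) (ε 1) (ε 1)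
          - fderiv ℝ (fun z => fderiv ℝ F z (chartField p Y z)) (base p)
            (christoffelVec gS p (base p) (ε 0) (ε 0)
              + christoffelVec gS p (base p) (ε 1) (ε 1)) := by
      rw [map_add]; abel
    rw [hsum, hbo]
    ring
  have hXs : ∀ q, ContDiffAt ℝ ∞ (chartField q X) (base q) := contDiffAt_chartField hX.smooth
  have hJX := isCoordHarmonic_complex_base hΦ hX hJ
  have hXh := eventually_isCoordHarmonic hΦ hXs (isCoordHarmonic_base hΦ hX) p
  have hJXh := eventually_isCoordHarmonic hΦ (fun q => (hJX q).1) (fun q => (hJX q).2) p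
  rw [← hF] at hXh hJXh
  obtain ⟨α, β, hαβ⟩ := exists_coords_of_orthonormal (fderiv ℝ F (base p)) ε heF (X p)
  obtain ⟨α', β', hαβ'⟩ := exists_coords_of_orthonormal (fderiv ℝ F (base p)) ε heF (J p (X p))
  have hip : ∀ a b a' b' : ℝ, (inner ℝ (fderiv ℝ F (base p) (a • ε 0 + b • ε 1))
      (fderiv ℝ F (base p) (a' • ε 0 + b' • ε 1)) : ℝ) = a * a' + b * b' := by
    intro a b a' b'
    simp only [map_add, map_smul, inner_add_left, inner_add_right, inner_smul_left,
      inner_smul_right, heF, conj_trivial]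
    simp
    ring
  have hgS : ∀ v w : TangentSpace (𝓡 2) p, gS.inner p v w
      = inner ℝ (fderiv ℝ F (base p) v) (fderiv ℝ F (base p) w) := fun v w => by
    rw [hF]; exact hΦ.inner_eq v w
  have hXX : gS.inner p (X p) (X p) = α ^ 2 + β ^ 2 := by
    have := hip α β α β
    rw [← hαβ] at this
    rw [hgS, this]; ring
  have hJJ : α' ^ 2 + β' ^ 2 = α ^ 2 + β ^ 2 := by
    have h1 := hip α' β' α' β'
    rw [← hαβ'] at h1
    have h2 := hJ.skew p (X p) (J p (X p))
    rw [hJ.sq, map_neg, neg_neg, hXX, hgS, h1] at h2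
    linarith
  have hXJ : α * α' + β * β' = 0 := by
    have h1 := hip α β α' β'
    rw [← hαβ, ← hαβ'] at h1
    have h2 := hJ.skew p (X p) (X p)
    rw [gS.symm, hgS, h1] at h2
    linarith
  obtain ⟨r1, r2, r3⟩ := rotation_relations hJJ hXJ
  have k1 := key X (hXs p) hXh α β hαβ
  have k2 := key _ (hJX p).1 hJXh α' β' hαβ'
  have hνu : ∀ a b, inner ℝ (u a) (ν b) = (0 : ℝ) := by
    intro a b
    have h1 := mvfderiv_eq_fderiv_base (p := ψ p) (hφ.smooth.mdifferentiable (by simp) (ψ p)) (f a)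
    rw [hua, hG]
    exact (congrArg (fun x => (inner ℝ x (ν b) : ℝ)) h1).symm.trans (hν.normal b (f a))
  have hsff : ∀ (b : Fin (n - 3)) (v w : E 3), euclideanSFF φ (ν b) (ψ p) v w
      = inner ℝ (B v w) (ν b) := by
    intro b v w
    have h1 : (inner ℝ (B v w) (ν b) : ℝ) = inner ℝ (D2 G (base (ψ p)) v w) (ν b) := by
      rw [hB, normalHess_apply, normalPart, inner_sub_left, sum_inner, sub_eq_self]
      exact Finset.sum_eq_zero fun a _ => by rw [inner_smul_left, hνu, mul_zero]
    rw [h1, ← fderiv_fderiv_apply hGs, hG]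
    change inner ℝ (fderiv ℝ (fun z => fderiv ℝ (φ ∘ (extChartAt (𝓡 3) (ψ p)).symm) z
      (toChart (ψ p) (ψ p) w)) (base (ψ p)) (toChart (ψ p) (ψ p) v)) (ν b) = _
    have hv : ∀ x : E 3, toChart (ψ p) (ψ p) x = x := toChart_self (ψ p)
    rw [hv, hv]
  have hsff' : ∀ (i : Fin 2) (b : Fin (n - 3)) (v : E 2),
      euclideanSFF φ (ν b) (ψ p) (mfderiv (𝓡 2) (𝓡 3) ψ p (e i)) (mfderiv (𝓡 2) (𝓡 3) ψ p v)
        = inner ℝ (B (C (ε i)) (C v)) (ν b) := by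
    intro i b v
    rw [hε]
    exact (congrArg₂ (fun x y => euclideanSFF φ (ν b) (ψ p) x y) (hψC (e i)) (hψC v)).trans
      (hsff b _ _)
  have hpars : ∀ v w, ∑ b, (inner ℝ (B v w) (ν b) : ℝ) ^ 2 = inner ℝ (B v w) (B v w) := fun v w =>
    sum_sq_inner_normal (by omega) huo hν.orthonormal hνu (hBu v w)
  have hrhs : ∑ a : Fin (n - 3), ∑ i : Fin 2,
          (euclideanSFF φ (ν a) (ψ p) (mfderiv (𝓡 2) (𝓡 3) ψ p (e i))
              (mfderiv (𝓡 2) (𝓡 3) ψ p (X p)) ^ 2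
            + euclideanSFF φ (ν a) (ψ p) (mfderiv (𝓡 2) (𝓡 3) ψ p (e i))
              (mfderiv (𝓡 2) (𝓡 3) ψ p (J p (X p))) ^ 2)
      = ∑ i : Fin 2, (inner ℝ (B (C (ε i)) (C (α • ε 0 + β • ε 1)))
            (B (C (ε i)) (C (α • ε 0 + β • ε 1)))
          + inner ℝ (B (C (ε i)) (C (α' • ε 0 + β' • ε 1)))
            (B (C (ε i)) (C (α' • ε 0 + β' • ε 1)))) := by
    rw [Finset.sum_comm]
    refine Finset.sum_congr rfl fun i _ => ?_
    rw [← hpars, ← hpars, ← Finset.sum_add_distrib]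
    refine Finset.sum_congr rfl fun b _ => ?_
    rw [← hαβ, ← hαβ']
    exact congrArg₂ (fun x y : ℝ => x ^ 2 + y ^ 2) (hsff' i b (X p)) (hsff' i b (J p (X p)))
  rw [hrhs, k1, k2, hXX, Fin.sum_univ_two, hA, hScal, sum_gaussForm_three hBsymm, ← hRic, hf0, hf1]
  simp only [map_add, map_smul]
  rw [hBsymm (C (ε 1)) (C (ε 0)), ← hb00, ← hb01, ← hb11]
  simp only [inner_add_left, inner_add_right, inner_smul_left, inner_smul_right, conj_trivial,
    real_inner_comm b00 b01, real_inner_comm b01 b11]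
  linear_combination
    (inner ℝ b00 b11 - inner ℝ b01 b01 + (h 0 0 * h 1 1 - h 0 1 ^ 2) + ricci gM (ψ p) (N p) (N p)
      + (h 0 0 ^ 2 + 2 * h 0 1 ^ 2 + h 1 1 ^ 2) - h 0 0 ^ 2 - h 0 1 ^ 2) * r1
    + (inner ℝ b00 b11 - inner ℝ b01 b01 + (h 0 0 * h 1 1 - h 0 1 ^ 2) + ricci gM (ψ p) (N p) (N p)
      + (h 0 0 ^ 2 + 2 * h 0 1 ^ 2 + h 1 1 ^ 2) - h 0 1 ^ 2 - h 1 1 ^ 2) * r2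
    - 2 * (h 0 0 * h 0 1 + h 0 1 * h 1 1) * r3
    + (α ^ 2 + β ^ 2) * (h 0 0 + h 1 1 + 2 * H) * hH'
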